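/- Let $\Omega=[0,2\pi]^2$ with periodic boundary conditions, let $T>0$ and let $\theta_0\in L^2(\Omega)$ be periodic. Let $\theta\in L^\infty([0,T];L^2(\Omega))$ be a weak solution of the inviscid quasi-geostrophic initial value problem $$\partial_t\theta+u\cdot\nabla\theta=0,\qquad u=(-\mathcal R_2\theta,\mathcal R_1\theta),\qquad \theta(\cdot,0)=\theta_0,$$ where $\mathcal R_j$ is the periodic Riesz transform, $\widehat{\mathcal R_jf}(k)=-i\frac{k_j}{|k|}\widehat f(k)$ for $k\in\mathbb Z^2\setminus\{0\}$ and $\widehat{\mathcal R_jf}(0)=0$. That is, for every smooth $\psi(t,x)$, periodic in $x$, with compact support in time in $[0,T)$, $$\int_0^T\!\!\int_\Omega\theta\,(\partial_t\psi+u\cdot\nabla\psi)\,dx\,dt+\int_\Omega\theta_0\,\psi(0,\cdot)\,dx=0 .$$ Let $G:\mathbb R\to\mathbb R$ be $C^2$ and strictly convex with bounded derivative $G'$. For a mollifier $\varphi$ on $\mathbb R^2$ (smooth, nonnegative, compactly supported, $\int\varphi=1$) and $\varepsilon>0$ write $f_\varepsilon=\varphi_\varepsilon*f$, where $\varphi_\varepsilon(x)=\varepsilon^{-2}\varphi(x/\varepsilon)$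 and the convolution is in the space variable. Then, as $\varepsilon\to0^+$, the functions $$G''(\theta_\varepsilon)\,\nabla\theta_\varepsilon\cdot\big(u_\varepsilon\theta_\varepsilon-(u\theta)_\varepsilon\big)$$ converge in the sense of distributions on $(0,T)\times\Omega$ (periodic in $x$) to a distribution $F(G,\theta)$, which does not depend on $\varphi$, and $$\partial_tG(\theta)+u\cdot\nabla G(\theta)=-F(G,\theta)$$ in the sense of distributions on $(0,T)\times\Omega$, where $u\cdot\nabla G(\theta)$ means $\nabla\cdot(u\,G(\theta))$, since $\nabla\cdot u=0$. -/

import Mathlib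

open MeasureTheory Filter Set
open scoped Topology ContDiff

namespace QG

/-- The plane `ℝ²` with the Euclidean norm. -/
abbrev Plane := EuclideanSpace ℝ (Fin 2)

/-- The period box `Ω = [0, 2π]²`. -/
def box : Set Plane := {x | ∀ i, x i ∈ Icc 0 (2 * Real.pi)}

/-- The space-time domain `(0, T) × Ω` over which integrals are taken. -/
def slab (T : ℝ) : Set (ℝ × Plane) := Ioo 0 T ×ˢ box

/-- `2π`-periodicity in each of the two coordinate directions. Functions on the torus are
represented by periodic functions on the plane. -/
def IsPeriodic {α : Type*} (f : Plane → α) : Prop :=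
  ∀ (i : Fin 2) (x : Plane), f (x + EuclideanSpace.single i (2 * Real.pi)) = f x

/-! ### Periodic Riesz transforms -/

/-- `(2π)⁻² ∫_Ω f(x) exp(-i k·x) dx`. -/
noncomputable def fourierCoeffBox (f : Plane → ℝ) (k : Fin 2 → ℤ) : ℂ :=
  (1 / (2 * (Real.pi : ℂ)) ^ 2) *
    ∫ x in box, (f x : ℂ) * Complex.exp (-(Complex.I * ∑ i, (k i : ℂ) * (x i : ℂ)))

/-- The symbol `-i k_j / |k|` of the `j`-th Riesz transform (coordinates are numbered `0, 1`),
set to `0` at `k = 0`. -/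
noncomputable def rieszSymbol (j : Fin 2) (k : Fin 2 → ℤ) : ℂ :=
  if k = 0 then 0
  else -Complex.I * ((k j : ℂ) / ((Real.sqrt (∑ i, (k i : ℝ) ^ 2) : ℝ) : ℂ))

/-- `g` is the `j`-th periodic Riesz transform of `f`: the function in `L²(Ω)` (unique up to null
sets) whose Fourier coefficients are those of `f` multiplied by the symbol. -/
structure IsRieszTransform (j : Fin 2) (f g : Plane → ℝ) : Prop where
  memLp : MemLp g 2 (volume.restrict box)
  fourier : ∀ k : Fin 2 → ℤ, fourierCoeffBox g k = rieszSymbol j k * fourierCoeffBox f k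

/-- `v = (-R₂ f, R₁ f)`. -/
def IsVelocityOf (f : Plane → ℝ) (v : Plane → Plane) : Prop :=
  IsRieszTransform 1 f (fun x => -(v x 0)) ∧ IsRieszTransform 0 f (fun x => v x 1)

/-! ### Test functions and distributions, periodic in space -/

/-- Smooth functions `ψ(t, x)`, periodic in `x`, vanishing for `t` outside a compact subset
of `I`. For `I = (0, T)` these are the test functions on `(0, T) × Ω` with periodic boundary
conditions; for `I = (-∞, T)` their restrictions to `t ≥ 0` are the test functions on
`[0, T) × Ω`. -/
def testFunctions (I : Set ℝ) : Submodule ℝ (ℝ × Plane → ℝ) where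
  carrier := {ψ | ContDiff ℝ ∞ ψ ∧ (∀ t, IsPeriodic fun x => ψ (t, x)) ∧
    ∃ K : Set ℝ, IsCompact K ∧ K ⊆ I ∧ ∀ t ∉ K, ∀ x, ψ (t, x) = 0}
  add_mem' := by
    rintro a b ⟨ha, ha', K, hK, hKI, hKa⟩ ⟨hb, hb', L, hL, hLI, hLb⟩
    refine ⟨ha.add hb, fun t i x => ?_, K ∪ L, hK.union hL, union_subset hKI hLI,
      fun t ht x => ?_⟩
    · exact congrArg₂ (· + ·) (ha' t i x) (hb' t i x)
    · rw [mem_union, not_or] at ht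
      simp [hKa t ht.1 x, hLb t ht.2 x]
  zero_mem' := ⟨contDiff_const, fun _ _ _ => rfl, ∅, isCompact_empty, empty_subset _,
    fun _ _ _ => rfl⟩
  smul_mem' := by
    rintro c a ⟨ha, ha', K, hK, hKI, hKa⟩
    refine ⟨contDiff_const.smul ha, fun t i x => congrArg (c • ·) (ha' t i x), K, hK, hKI, fun t ht x => ?_⟩
    simp [hKa t ht x]

/-- `∂_t ψ`. -/
noncomputable def timeDeriv (ψ : ℝ × Plane → ℝ) (z : ℝ × Plane) : ℝ :=
  deriv (fun s => ψ (s, z.2)) z.1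

/-- `∇ψ`, the gradient in the space variable. -/
noncomputable def spaceGrad (ψ : ℝ × Plane → ℝ) (z : ℝ × Plane) : Plane :=
  gradient (fun y => ψ (z.1, y)) z.2

/-- A linear functional on test functions is a distribution if, on the test functions supported
in any fixed compact set of times in `I`, it is bounded by the suprema of finitely many
derivatives. -/
def IsDistribution {I : Set ℝ} (F : testFunctions I →ₗ[ℝ] ℝ) : Prop :=
  ∀ K : Set ℝ, IsCompact K → K ⊆ I → ∃ (N : ℕ) (C : ℝ), ∀ ψ : testFunctions I,
    (∀ t ∉ K, ∀ x, ψ.1 (t, x) = 0) →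
    ∀ M : ℝ, (∀ n ≤ N, ∀ z, ‖iteratedFDeriv ℝ n ψ.1 z‖ ≤ M) → |F ψ| ≤ C * M

/-- The functions `f ε` converge to `F` in the sense of distributions on `(0, T) × Ω` as
`ε → 0+`. -/
def ConvergesInDistribution (T : ℝ) (f : ℝ → ℝ × Plane → ℝ)
    (F : testFunctions (Ioo 0 T) →ₗ[ℝ] ℝ) : Prop :=
  (∀ ε > 0, IntegrableOn (f ε) (slab T)) ∧
  ∀ ψ : testFunctions (Ioo 0 T),
    Tendsto (fun ε => ∫ z in slab T, f ε z * ψ.1 z) (𝓝[>] 0) (𝓝 (F ψ))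

/-- `∂_t g + u·∇g = R` in the sense of distributions on `(0, T) × Ω`, for a divergence-free
field `u`, so that `u·∇g` is the distribution `∇·(g u)`. -/
def TransportEq (T : ℝ) (g : ℝ → Plane → ℝ) (u : ℝ → Plane → Plane)
    (R : testFunctions (Ioo 0 T) →ₗ[ℝ] ℝ) : Prop :=
  IntegrableOn (fun z : ℝ × Plane => g z.1 z.2) (slab T) ∧
  IntegrableOn (fun z : ℝ × Plane => g z.1 z.2 • u z.1 z.2) (slab T) ∧
  ∀ ψ : testFunctions (Ioo 0 T),
    -(∫ z in slab T, g z.1 z.2 *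
        (timeDeriv ψ.1 z + inner ℝ (u z.1 z.2) (spaceGrad ψ.1 z))) = R ψ

/-! ### Weak solutions -/

/-- `f ∈ L^∞([0, T]; L²(Ω))`, for a function `f(t, x)` periodic in `x`. -/
structure MemLinftyL2 (T : ℝ) (f : ℝ → Plane → ℝ) : Prop where
  periodic : ∀ t, IsPeriodic (f t)
  aestronglyMeasurable : AEStronglyMeasurable (fun z : ℝ × Plane => f z.1 z.2)
    (volume.restrict (Ioo 0 T ×ˢ univ))
  bound : ∃ C : NNReal, ∀ᵐ t ∂(volume.restrict (Ioo 0 T)),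
    eLpNorm (f t) 2 (volume.restrict box) ≤ C

/-- `θ ∈ L^∞([0, T]; L²)`, with velocity `u`, is a weak solution on `[0, T]` of
`θ_t + u·∇θ = 0`, `u = (-R₂ θ, R₁ θ)`, `θ(·, 0) = θ₀`. -/
structure IsWeakSolution (T : ℝ) (θ₀ : Plane → ℝ) (θ : ℝ → Plane → ℝ)
    (u : ℝ → Plane → Plane) : Prop where
  memLinftyL2 : MemLinftyL2 T θ
  velocity_periodic : ∀ t, IsPeriodic (u t)
  velocity_aestronglyMeasurable : AEStronglyMeasurable (fun z : ℝ × Plane => u z.1 z.2)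
    (volume.restrict (Ioo 0 T ×ˢ univ))
  velocity : ∀ᵐ t ∂(volume.restrict (Ioo 0 T)), IsVelocityOf (θ t) (u t)
  weak : ∀ ψ : testFunctions (Iio T),
    (∫ z in slab T, θ z.1 z.2 *
        (timeDeriv ψ.1 z + inner ℝ (u z.1 z.2) (spaceGrad ψ.1 z)))
      + ∫ x in box, θ₀ x * ψ.1 (0, x) = 0

/-! ### Mollification -/

/-- A mollifier on `ℝ²`: smooth, nonnegative, compactly supported, of integral one. -/
structure IsMollifier (φ : Plane → ℝ) : Prop where
  contDiff : ContDiff ℝ ∞ φ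
  compactSupport : HasCompactSupport φ
  nonneg : ∀ x, 0 ≤ φ x
  integral_eq_one : ∫ x, φ x = 1

/-- `f_ε = φ_ε * f` in the space variable, with `φ_ε(x) = ε⁻² φ(x / ε)`. -/
noncomputable def mollify {E : Type*} [NormedAddCommGroup E] [NormedSpace ℝ E]
    (φ : Plane → ℝ) (ε : ℝ) (f : Plane → E) : Plane → E :=
  convolution (fun y => (ε ^ 2)⁻¹ * φ (ε⁻¹ • y)) f (ContinuousLinearMap.lsmul ℝ ℝ) volume

/-- `G''(θ_ε) ∇θ_ε · (u_ε θ_ε - (u θ)_ε)`. -/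
noncomputable def defect (φ : Plane → ℝ) (G : ℝ → ℝ) (θ : ℝ → Plane → ℝ)
    (u : ℝ → Plane → Plane) (ε : ℝ) (z : ℝ × Plane) : ℝ :=
  deriv (deriv G) (mollify φ ε (θ z.1) z.2) *
    inner ℝ (gradient (mollify φ ε (θ z.1)) z.2)
      (mollify φ ε (θ z.1) z.2 • mollify φ ε (u z.1) z.2
        - mollify φ ε (fun y => θ z.1 y • u z.1 y) z.2)

end QG

namespace QG

/-! The required equation leaves one candidate, `F(ψ) = ∫ G(θ) (∂_t ψ + u·∇ψ)`. Since `G` is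
Lipschitz, `G(θ)` and `u` are both square integrable, so this is a distribution of order one. No
mollifier enters it, and it satisfies the equation by construction (`limitDistribution`). The
content is that the defects converge to it.

Mollifying in space gives `∂_t θ_ε = -div (uθ)_ε`, weakly in time at each point `x`
(`integral_conv_mul_deriv`). The right side is integrable in time, so `θ_ε(·, x)` has an absolutely
continuous version, and the Lipschitz function `G` obeys the chain rule `∂_t G(θ_ε) = -G'(θ_ε) div
(uθ)_ε` (`integral_comp_mul_deriv_of_weakDeriv`). In space all mollified functions are smooth and
`div u_ε = 0`, so a periodic divergence identity (`integral_box_balance`) can be combined with the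
time identity into (`integral_slab_defect`)

`∫ defect ψ = ∫ G(θ_ε) (∂_t ψ + u_ε·∇ψ) - ∫ G'(θ_ε) (θ_ε u_ε - (uθ)_ε)·∇ψ`.

As `ε → 0`, `G(θ_ε) → G(θ)` and `u_ε → u` in `L²`, so the first integral tends to `F(ψ)`. The
products `θ_ε u_ε` and `(uθ)_ε` have the same limit `uθ` in `L¹`, and `G'` is bounded, so the second
integral tends to zero.

Two tools support this. Parseval's identity on the box shows that `u` is bounded in `L²` by `θ` and
is divergence free. Periodization turns a kernel on the plane into a periodic test function, so that
the weak formulation can be tested with `y ↦ φ_ε(x - y)`. -/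

/-! ### The lattice of periods -/

/-- The element `2π k` of the period lattice. -/
noncomputable def shift (k : Fin 2 → ℤ) : Plane := WithLp.toLp 2 fun i => (k i : ℝ) * (2 * Real.pi)

@[simp] lemma shift_apply (k : Fin 2 → ℤ) (i : Fin 2) : shift k i = (k i : ℝ) * (2 * Real.pi) := rfl

lemma shift_add (k l : Fin 2 → ℤ) : shift (k + l) = shift k + shift l := by
  ext i; simp [add_mul]

lemma IsPeriodic.add_shift {α : Type*} {f : Plane → α} (hf : IsPeriodic f) (x : Plane)
    (k : Fin 2 → ℤ) : f (x + shift k) = f x := by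
  have h : shift k = k 0 • EuclideanSpace.single (0 : Fin 2) (2 * Real.pi)
      + k 1 • EuclideanSpace.single (1 : Fin 2) (2 * Real.pi) := by
    ext i; fin_cases i <;> simp
  have h0 : Function.Periodic f (EuclideanSpace.single (0 : Fin 2) (2 * Real.pi)) := hf 0
  have h1 : Function.Periodic f (EuclideanSpace.single (1 : Fin 2) (2 * Real.pi)) := hf 1
  rw [h, ← add_assoc, h1.zsmul, h0.zsmul]

lemma isPeriodic_of_add_shift {α : Type*} {f : Plane → α} (h : ∀ x k, f (x + shift k) = f x) :
    IsPeriodic f := by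
  intro i x
  have : EuclideanSpace.single i (2 * Real.pi) = shift (Pi.single i 1) := by
    ext j
    by_cases hj : j = i
    · subst hj; simp
    · simp [hj]
  rw [this, h]

lemma abs_apply_le_norm (x : Plane) (i : Fin 2) : |x i| ≤ ‖x‖ := by
  simpa using PiLp.norm_apply_le x i

lemma finite_norm_shift_le (R : ℝ) : {k : Fin 2 → ℤ | ‖shift k‖ ≤ R}.Finite := by
  refine (Set.finite_Icc (fun _ => -⌈R⌉) (fun _ => ⌈R⌉)).subset fun k hk => ?_
  have key : ∀ i, |k i| ≤ ⌈R⌉ := fun i => by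
    have h1 : |(k i : ℝ) * (2 * Real.pi)| ≤ R := (abs_apply_le_norm (shift k) i).trans hk
    rw [abs_mul, abs_of_pos Real.two_pi_pos] at h1
    have h2 : (|k i| : ℝ) ≤ R := by
      nlinarith [abs_nonneg (k i : ℝ), Real.pi_gt_three]
    have : ((|k i| : ℤ) : ℝ) ≤ ⌈R⌉ := by
      push_cast; exact h2.trans (Int.le_ceil R)
    exact_mod_cast this
  exact ⟨fun i => (abs_le.1 (key i)).1, fun i => (abs_le.1 (key i)).2⟩

/-! ### The period cell -/

/-- The half-open period cell `[0, 2π)²`. -/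
def cell : Set Plane := {x | ∀ i, x i ∈ Ico 0 (2 * Real.pi)}

lemma measurableSet_cell : MeasurableSet cell := by
  have : cell = ⋂ i, (fun x : Plane => x i) ⁻¹' Ico 0 (2 * Real.pi) := by
    ext; simp [cell]
  rw [this]
  exact .iInter fun i => measurableSet_Ico.preimage (by fun_prop)

lemma isClosed_box : IsClosed box := by
  have : box = ⋂ i, (fun x : Plane => x i) ⁻¹' Icc 0 (2 * Real.pi) := by
    ext; simp [box]
  rw [this]
  exact isClosed_iInter fun i => isClosed_Icc.preimage (by fun_prop)

/-- The farthest corner has norm `2π√2 < 9`; the round bound 10 serves below whenever the box must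
sit inside a ball. -/
lemma norm_le_of_mem_box {x : Plane} (hx : x ∈ box) : ‖x‖ ≤ 10 := by
  rw [EuclideanSpace.norm_eq, Real.sqrt_le_left (by norm_num), Fin.sum_univ_two]
  have h0 := hx 0
  have h1 := hx 1
  simp only [Real.norm_eq_abs, sq_abs]
  nlinarith [Real.pi_lt_d2, h0.1, h0.2, h1.1, h1.2]

lemma isCompact_box : IsCompact box :=
  Metric.isCompact_of_isClosed_isBounded isClosed_box
    ((Metric.isBounded_closedBall (x := (0 : Plane)) (r := 10)).subset fun x hx => by
      simpa using norm_le_of_mem_box hx)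

lemma measurableSet_box : MeasurableSet box := isClosed_box.measurableSet

instance : IsFiniteMeasure (volume.restrict box) :=
  ⟨by simpa using isCompact_box.measure_lt_top⟩

lemma box_eq_preimage : box = (WithLp.ofLp : Plane → Fin 2 → ℝ) ⁻¹'
    Icc (fun _ => 0) (fun _ => 2 * Real.pi) := by
  ext x
  simp only [box, mem_ofPred_eq, mem_preimage, ← pi_univ_Icc, Set.mem_pi, mem_univ, true_imp_iff]

/-- Translates of the closed box overlap along edges, while those of the half-open cell tile the
plane exactly. The two sets differ by a null set, so integrals may pass from one to the other. -/
lemma cell_ae_eq_box : cell =ᵐ[volume] box := by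
  have h1 : cell = (WithLp.ofLp : Plane → Fin 2 → ℝ) ⁻¹'
      (pi univ fun _ => Ico 0 (2 * Real.pi)) := by
    ext x; simp [cell]
  rw [h1, box_eq_preimage]
  exact (PiLp.volume_preserving_ofLp (Fin 2)).quasiMeasurePreserving.preimage_ae_eq
    Measure.univ_pi_Ico_ae_eq_Icc

lemma restrict_cell : (volume.restrict cell : Measure Plane) = volume.restrict box :=
  Measure.restrict_congr_set cell_ae_eq_box

lemma cell_subset_box : cell ⊆ box := fun _ hx i => ⟨(hx i).1, (hx i).2.le⟩

/-- The translate of the period cell by `2π k`. -/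
def cellAt (k : Fin 2 → ℤ) : Set Plane := {x | x - shift k ∈ cell}

lemma preimage_cellAt (k : Fin 2 → ℤ) : (fun x => x + shift k) ⁻¹' cellAt k = cell := by
  ext x; simp [cellAt]

lemma measurableSet_cellAt (k : Fin 2 → ℤ) : MeasurableSet (cellAt k) :=
  measurableSet_cell.preimage (measurable_id.sub_const (shift k))

/-- The index of the cell is a function of the point, which yields both that the cells cover the
plane and that they are disjoint. -/
lemma mem_cellAt_iff {k : Fin 2 → ℤ} {x : Plane} :
    x ∈ cellAt k ↔ ∀ i, ⌊x i / (2 * Real.pi)⌋ = k i := by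
  simp only [cellAt, cell, mem_ofPred_eq, PiLp.sub_apply, shift_apply, mem_Ico]
  refine forall_congr' fun i => ?_
  rw [Int.floor_eq_iff, le_div_iff₀ Real.two_pi_pos, div_lt_iff₀ Real.two_pi_pos]
  constructor
  · rintro ⟨h1, h2⟩; constructor <;> linarith
  · rintro ⟨h1, h2⟩; constructor <;> linarith

lemma iUnion_cellAt : ⋃ k, cellAt k = univ := by
  refine eq_univ_of_forall fun x => mem_iUnion.2 ⟨fun i => ⌊x i / (2 * Real.pi)⌋, ?_⟩
  simp [mem_cellAt_iff]

lemma pairwise_disjoint_cellAt : Pairwise (Function.onFun Disjoint cellAt) := by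
  intro k l hkl
  refine disjoint_left.2 fun x hk hl => hkl ?_
  rw [mem_cellAt_iff] at hk hl
  ext i
  rw [← hk, ← hl]

lemma lintegral_cellAt (k : Fin 2 → ℤ) (g : Plane → ENNReal) :
    ∫⁻ x in cellAt k, g x = ∫⁻ x in box, g (x + shift k) := by
  rw [← restrict_cell, ← preimage_cellAt k]
  exact ((measurePreserving_add_right volume (shift k)).setLIntegral_comp_preimage_emb
    (measurableEmbedding_addRight _) g _).symm

lemma integral_cellAt {E : Type*} [NormedAddCommGroup E] [NormedSpace ℝ E] (k : Fin 2 → ℤ)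
    (g : Plane → E) : ∫ x in cellAt k, g x = ∫ x in box, g (x + shift k) := by
  rw [← restrict_cell, ← preimage_cellAt k]
  exact ((measurePreserving_add_right volume (shift k)).setIntegral_preimage_emb
    (measurableEmbedding_addRight _) g _).symm

/-- The integral over a ball of a periodic function is controlled by the one over the period
box. -/
lemma exists_lintegral_closedBall_le (R : ℝ) : ∃ N : NNReal, ∀ g : Plane → ENNReal, IsPeriodic g →
    ∫⁻ x in Metric.closedBall 0 R, g x ≤ N * ∫⁻ x in box, g x := by
  -- A cell meeting the ball of radius `R` has a translation vector of norm at most `R + 10`; only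
  -- finitely many cells qualify, and their number is the constant.
  set S := (finite_norm_shift_le (R + 10)).toFinset
  refine ⟨S.card, fun g hg => ?_⟩
  have hsub : Metric.closedBall (0 : Plane) R ⊆ ⋃ k ∈ S, cellAt k := by
    intro x hx
    obtain ⟨k, hk⟩ := mem_iUnion.1 (iUnion_cellAt.symm ▸ mem_univ x : x ∈ ⋃ k, cellAt k)
    refine mem_iUnion₂.2 ⟨k, ?_, hk⟩
    simp only [S, Finite.mem_toFinset, mem_ofPred_eq]
    have h1 := norm_le_of_mem_box (cell_subset_box hk)
    have h2 : ‖x‖ ≤ R := by simpa using hx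
    calc ‖shift k‖ = ‖x - (x - shift k)‖ := by congr 1; abel
      _ ≤ R + 10 := (norm_sub_le _ _).trans (by linarith)
  calc ∫⁻ x in Metric.closedBall 0 R, g x ≤ ∫⁻ x in ⋃ k ∈ S, cellAt k, g x :=
        lintegral_mono_set hsub
    _ = ∑ k ∈ S, ∫⁻ x in cellAt k, g x := lintegral_biUnion_finset
        (fun k _ l _ h => pairwise_disjoint_cellAt h) (fun k _ => measurableSet_cellAt k) g
    _ = ∑ k ∈ S, ∫⁻ x in box, g x := by
        refine Finset.sum_congr rfl fun k _ => ?_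
        rw [lintegral_cellAt]
        simp_rw [hg.add_shift]
    _ = _ := by simp

/-- The `L^p` norm over a ball of a periodic function is controlled by the one over the period
box. -/
lemma exists_eLpNorm_closedBall_le (R : ℝ) {p : ENNReal} (hp0 : p ≠ 0) (hp : p ≠ ⊤) :
    ∃ N : NNReal, ∀ {E : Type} [NormedAddCommGroup E] (f : Plane → E), IsPeriodic f →
    eLpNorm f p (volume.restrict (Metric.closedBall 0 R)) ≤
      N * eLpNorm f p (volume.restrict box) := by
  obtain ⟨N, hN⟩ := exists_lintegral_closedBall_le R
  refine ⟨N ^ (1 / p.toReal), fun f hf => ?_⟩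
  rw [eLpNorm_eq_lintegral_rpow_enorm_toReal hp0 hp, eLpNorm_eq_lintegral_rpow_enorm_toReal hp0 hp,
    ENNReal.coe_rpow_of_nonneg _ (by positivity), ← ENNReal.mul_rpow_of_nonneg _ _ (by positivity)]
  gcongr
  exact hN _ fun i x => by rw [hf i x]

/-! ### Periodization -/

/-- The sum of the translates of `η` by the period lattice. -/
noncomputable def periodize (η : Plane → ℝ) (y : Plane) : ℝ := ∑ᶠ k, η (y + shift k)

lemma isPeriodic_periodize (η : Plane → ℝ) : IsPeriodic (periodize η) := by
  refine isPeriodic_of_add_shift fun x k => ?_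
  simp only [periodize]
  rw [← finsum_comp_equiv (f := fun l => η (x + shift l)) (Equiv.addLeft k)]
  simp [shift_add, add_assoc]

/-- On a ball, the periodization is a finite sum. -/
lemma exists_periodize_eq_sum (R ρ : ℝ) : ∃ S : Finset (Fin 2 → ℤ), ∀ y : Plane, ‖y‖ ≤ R →
    ∀ η : Plane → ℝ, (∀ x, ρ < ‖x‖ → η x = 0) →
      (∀ k ∉ S, η (y + shift k) = 0) ∧ periodize η y = ∑ k ∈ S, η (y + shift k) := by
  -- The index set depends on `R` and `ρ` only, hence serves a whole neighbourhood of a point, and a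
  -- function together with its derivatives.
  refine ⟨(finite_norm_shift_le (R + ρ)).toFinset, fun y hy η hη => ?_⟩
  have key : ∀ k ∉ (finite_norm_shift_le (R + ρ)).toFinset, η (y + shift k) = 0 := by
    intro k hk
    simp only [Finite.mem_toFinset, mem_ofPred_eq, not_le] at hk
    refine hη _ ?_
    have : ‖shift k‖ ≤ ‖y + shift k‖ + ‖y‖ := by
      simpa using norm_sub_le (y + shift k) y
    linarith
  -- The summand has finite support, so the `finsum` is a true sum and not its default value 0.
  refine ⟨key, finsum_eq_sum_of_support_subset _ fun k hk => ?_⟩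
  by_contra h
  exact hk (key k (by simpa using h))

lemma _root_.HasCompactSupport.exists_norm_bound {η : Plane → ℝ} (h : HasCompactSupport η) :
    ∃ ρ : ℝ, 0 ≤ ρ ∧ ∀ x, ρ < ‖x‖ → η x = 0 := by
  obtain ⟨ρ, hρ⟩ := h.isBounded.subset_closedBall (0 : Plane)
  refine ⟨max ρ 0, le_max_right _ _, fun x hx => image_eq_zero_of_notMem_tsupport fun hx' => ?_⟩
  have := hρ hx'
  simp only [mem_closedBall_zero_iff] at this
  exact absurd ((le_max_left _ _).trans_lt hx) (not_lt.2 this)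

lemma eventually_norm_le (y : Plane) : ∀ᶠ z in 𝓝 y, ‖z‖ ≤ ‖y‖ + 1 :=
  (continuous_norm.tendsto y).eventually (Iic_mem_nhds (by linarith))

lemma contDiff_periodize {η : Plane → ℝ} (hη : ContDiff ℝ ∞ η) (h : HasCompactSupport η) :
    ContDiff ℝ ∞ (periodize η) := by
  obtain ⟨ρ, -, hρ⟩ := h.exists_norm_bound
  refine contDiff_iff_contDiffAt.2 fun y => ?_
  obtain ⟨S, hS⟩ := exists_periodize_eq_sum (‖y‖ + 1) ρ
  have : periodize η =ᶠ[𝓝 y] fun z => ∑ k ∈ S, η (z + shift k) := by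
    filter_upwards [eventually_norm_le y] with z hz using (hS z hz η hρ).2
  refine ContDiffAt.congr_of_eventuallyEq ?_ this
  exact (ContDiff.sum fun k _ => hη.comp (contDiff_id.add contDiff_const)).contDiffAt

/-- Near `y` the periodization is one fixed finite sum, which can be differentiated term by term;
the derivative of `η` vanishes outside the same ball, so the same index set computes its
periodization. -/
lemma fderiv_periodize {η : Plane → ℝ} (hη : ContDiff ℝ ∞ η) (h : HasCompactSupport η)
    (y v : Plane) : fderiv ℝ (periodize η) y v = periodize (fun x => fderiv ℝ η x v) y := by
  obtain ⟨ρ, -, hρ⟩ := h.exists_norm_bound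
  have hρ' : ∀ x, ρ < ‖x‖ → fderiv ℝ η x v = 0 := by
    intro x hx
    have : η =ᶠ[𝓝 x] fun _ => 0 := by
      filter_upwards [(isOpen_lt continuous_const continuous_norm).mem_nhds hx] with z hz
        using hρ z hz
    rw [this.fderiv_eq]; simp
  obtain ⟨S, hS⟩ := exists_periodize_eq_sum (‖y‖ + 1) ρ
  have : periodize η =ᶠ[𝓝 y] fun z => ∑ k ∈ S, η (z + shift k) := by
    filter_upwards [eventually_norm_le y] with z hz using (hS z hz η hρ).2
  rw [this.fderiv_eq, (hS y (by linarith) _ hρ').2, fderiv_fun_sum, _root_.sum_apply]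
  · simp [fderiv_comp_add_right]
  · intro k _
    exact ((hη.differentiable (by simp)).comp (differentiable_id.add_const _)).differentiableAt

/-- Unfolding: integrating a periodic function against `η` over the plane amounts to integrating
it against the periodization of `η` over the period box. -/
lemma integral_mul_periodize {f η : Plane → ℝ} (hf : IsPeriodic f) (hfm : LocallyIntegrable f)
    (hη : Continuous η) (h : HasCompactSupport η) :
    ∫ x in box, f x * periodize η x = ∫ x, f x * η x := by
  obtain ⟨ρ, -, hρ⟩ := h.exists_norm_bound
  obtain ⟨S, hS⟩ := exists_periodize_eq_sum 10 ρ
  have hint : Integrable (fun x => f x * η x) := by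
    simpa [mul_comm] using hfm.integrable_smul_left_of_hasCompactSupport hη h
  have hsum : ∫ x, f x * η x = ∑' k, ∫ x in box, f x * η (x + shift k) := by
    -- Cut the plane into cells and translate each back to the box: periodicity leaves `f` unchanged
    -- and the translates of `η` add up to its periodization.
    rw [← setIntegral_univ, ← iUnion_cellAt, integral_iUnion measurableSet_cellAt
      pairwise_disjoint_cellAt hint.integrableOn]
    refine tsum_congr fun k => ?_
    rw [integral_cellAt]
    simp_rw [hf.add_shift]
  rw [hsum, tsum_eq_sum (s := S), ← integral_finsetSum]
  · refine setIntegral_congr_fun measurableSet_box fun x hx => ?_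
    simp only [(hS x (norm_le_of_mem_box hx) η hρ).2, Finset.mul_sum]
  · intro k _
    have := hfm.integrableOn_isCompact isCompact_box
    exact this.mul_continuousOn_of_subset
      (hη.comp (continuous_add_const (shift k))).continuousOn measurableSet_box isCompact_box
      subset_rfl
  · intro k hk
    refine (setIntegral_congr_fun (g := 0) measurableSet_box fun x hx => ?_).trans (by simp)
    simp [(hS x (norm_le_of_mem_box hx) η hρ).1 k hk]

/-! ### Integrals of derivatives over the period box -/

/-- The partial derivatives of a periodic `C¹` function have mean zero. -/
lemma integral_box_partialDeriv_eq_zero {E : Type*} [NormedAddCommGroup E] [NormedSpace ℝ E]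
    [CompleteSpace E] {f : Plane → E} (hf : ContDiff ℝ 1 f) (hper : IsPeriodic f) (i : Fin 2) :
    ∫ x in box, fderiv ℝ f x (EuclideanSpace.single i 1) = 0 := by
  set L : (Fin 2 → ℝ) ≃L[ℝ] Plane := (EuclideanSpace.equiv (Fin 2) ℝ).symm
  have hL : ∀ x, L x = WithLp.toLp 2 x := fun x => rfl
  have hcont : Continuous (fun x => fderiv ℝ f x (EuclideanSpace.single i 1)) :=
    (hf.continuous_fderiv (by simp)).clm_apply continuous_const
  have hvol : ∫ x in box, fderiv ℝ f x (EuclideanSpace.single i 1)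
      = ∫ x in Icc (fun _ => 0) (fun _ => 2 * Real.pi),
        fderiv ℝ f (L x) (EuclideanSpace.single i 1) := by
    rw [box_eq_preimage]
    exact (PiLp.volume_preserving_ofLp (Fin 2)).setIntegral_preimage_emb
      (MeasurableEquiv.toLp 2 (Fin 2 → ℝ)).symm.measurableEmbedding
      (fun x => fderiv ℝ f (L x) (EuclideanSpace.single i 1)) _
  rw [hvol]
  have hle : (fun _ : Fin 2 => (0 : ℝ)) ≤ fun _ => 2 * Real.pi := fun _ => Real.two_pi_pos.le
  -- The divergence theorem for the field whose only nonzero component is `f`, in direction `i`: its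
  -- divergence is the partial derivative and only the two faces orthogonal to `i` contribute.
  have hdiv := integral_divergence_of_hasFDerivAt_off_countable' (E := E)
    (fun _ : Fin 2 => (0 : ℝ)) (fun _ => 2 * Real.pi) hle
    (fun j x => if j = i then f (L x) else 0)
    (fun j x => if j = i then (fderiv ℝ f (L x)).comp (L : (Fin 2 → ℝ) →L[ℝ] Plane) else 0)
    ∅ countable_empty
    (fun j => by
      split_ifs
      · exact (hf.continuous.comp L.continuous).continuousOn
      · exact continuousOn_const)
    (fun x _ j => by
      split_ifs
      · exact ((hf.differentiable (by simp)) _).hasFDerivAt.comp x L.hasFDerivAt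
      · exact hasFDerivAt_const _ _)
    ?_
  · have hLi : L (Pi.single i 1) = EuclideanSpace.single i 1 := rfl
    simp only [Finset.sum_ite_eq', Finset.mem_univ, if_true, apply_ite DFunLike.coe, ite_apply,
      ContinuousLinearMap.comp_apply, ContinuousLinearEquiv.coe_coe, hLi,
      _root_.zero_apply] at hdiv
    rw [hdiv]
    refine Finset.sum_eq_zero fun j _ => ?_
    split_ifs with hj
    · subst hj
      rw [sub_eq_zero]
      refine setIntegral_congr_fun measurableSet_Icc fun x _ => ?_
      -- Opposite faces differ by a period, so their contributions cancel.
      rw [← hper j (L (j.insertNth 0 x))]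
      congr 1
      ext l
      induction l using Fin.succAboveCases j <;> simp [hL]
    · simp
  · have hLi : L (Pi.single i 1) = EuclideanSpace.single i 1 := rfl
    simp only [Finset.sum_ite_eq', Finset.mem_univ, if_true, apply_ite DFunLike.coe, ite_apply,
      ContinuousLinearMap.comp_apply, ContinuousLinearEquiv.coe_coe, hLi,
      _root_.zero_apply]
    exact (hcont.comp L.continuous).continuousOn.integrableOn_compact isCompact_Icc

/-! ### Parseval's identity on the period box -/

section Parseval

open UnitAddTorus ComplexConjugate

/-- The normalised measure on `ℝ / ℤ`, as in Mathlib's theory of multiple Fourier series. -/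
noncomputable local instance : MeasureSpace UnitAddCircle := ⟨AddCircle.haarAddCircle⟩

local instance : IsProbabilityMeasure (volume : Measure UnitAddCircle) :=
  inferInstanceAs (IsProbabilityMeasure AddCircle.haarAddCircle)

/-- The section of the covering `x ↦ x / 2π` of the torus with values in the period box. -/
noncomputable def torusSection (τ : UnitAddTorus (Fin 2)) : Plane :=
  (2 * Real.pi) • WithLp.toLp 2 (measurableEquivPiIoc (fun _ : Fin 2 => (0 : ℝ)) τ).1

lemma measurableEmbedding_scale : MeasurableEmbedding
    (fun x : Fin 2 → ℝ => (2 * Real.pi) • (WithLp.toLp 2 x : Plane)) :=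
  (measurableEmbedding_const_smul₀ Real.two_pi_pos.ne').comp
    (MeasurableEquiv.toLp 2 (Fin 2 → ℝ)).measurableEmbedding

lemma measurableSet_unitCell :
    MeasurableSet {x : Fin 2 → ℝ | ∀ i, x i ∈ Ioc ((fun _ => (0 : ℝ)) i) ((fun _ => (0 : ℝ)) i + 1)} :=
  MeasurableSet.univ_pi' (fun _ => measurableSet_Ioc)

lemma measurableEmbedding_torusSection : MeasurableEmbedding torusSection :=
  measurableEmbedding_scale.comp ((MeasurableEmbedding.subtype_coe measurableSet_unitCell).comp
    (measurableEquivPiIoc (fun _ : Fin 2 => (0 : ℝ))).measurableEmbedding)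

/-- The section takes values in `(0, 2π]²`, which is the box up to a null set, and scaling by `2π`
produces the factor `(2π)⁻²` of `fourierCoeffBox`. Hence the coefficients on the torus and on the
box coincide, and Parseval's identity transfers. -/
lemma measurePreserving_torusSection : MeasurePreserving torusSection volume
    (ENNReal.ofReal |((2 * Real.pi) ^ 2)⁻¹| • volume.restrict box) := by
  set s : Set Plane := (WithLp.ofLp : Plane → Fin 2 → ℝ) ⁻¹'
      (pi univ fun _ => Ioc 0 (2 * Real.pi))
  have hs : s =ᵐ[volume] box := by
    rw [box_eq_preimage]
    exact (PiLp.volume_preserving_ofLp (Fin 2)).quasiMeasurePreserving.preimage_ae_eq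
      Measure.univ_pi_Ioc_ae_eq_Icc
  have hsm : MeasurableSet s :=
    (MeasurableSet.univ_pi fun _ => measurableSet_Ioc).preimage
      (PiLp.volume_preserving_ofLp (Fin 2)).measurable
  have h1 : MeasurePreserving (fun x : Fin 2 → ℝ => (2 * Real.pi) • (WithLp.toLp 2 x : Plane))
      volume (ENNReal.ofReal |((2 * Real.pi) ^ 2)⁻¹| • volume) := by
    refine MeasurePreserving.comp (g := fun x : Plane => (2 * Real.pi) • x) ⟨by fun_prop, ?_⟩
      (PiLp.volume_preserving_toLp (Fin 2))
    rw [Measure.map_addHaar_smul _ Real.two_pi_pos.ne']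
    simp
  have h2 := h1.restrict_preimage hsm
  have h3 : (fun x : Fin 2 → ℝ => (2 * Real.pi) • (WithLp.toLp 2 x : Plane)) ⁻¹' s =
      {x : Fin 2 → ℝ | ∀ i, x i ∈ Ioc ((fun _ => (0 : ℝ)) i) ((fun _ => (0 : ℝ)) i + 1)} := by
    ext x
    simp [s, Real.pi_pos]
  rw [Measure.restrict_smul, Measure.restrict_congr_set hs, h3] at h2
  exact h2.comp ((measurePreserving_subtype_coe measurableSet_unitCell).comp
    (measurePreserving_equivPiIoc (fun _ : Fin 2 => (0 : ℝ))))

lemma integral_torusSection (h : Plane → ℂ) :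
    ∫ τ, h (torusSection τ) = (1 / (2 * (Real.pi : ℂ)) ^ 2) * ∫ x in box, h x := by
  rw [measurePreserving_torusSection.integral_comp measurableEmbedding_torusSection,
    integral_smul_measure, ENNReal.toReal_ofReal (abs_nonneg _), abs_of_nonneg (by positivity)]
  simp [Algebra.smul_def]

lemma mFourier_neg_apply (k : Fin 2 → ℤ) (τ : UnitAddTorus (Fin 2)) : mFourier (-k) τ =
    Complex.exp (-(Complex.I * ∑ i, (k i : ℂ) * (torusSection τ i : ℂ))) := by
  have key : ∀ i, fourier (-k i) (τ i) =
      Complex.exp (-(Complex.I * ((k i : ℂ) * (torusSection τ i : ℂ)))) := by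
    intro i
    have : τ i = (((AddCircle.equivIoc 1 0 (τ i)).1 : ℝ) : UnitAddCircle) := by
      exact ((AddCircle.equivIoc (1 : ℝ) 0).symm_apply_apply (τ i)).symm
    conv_lhs => rw [this, fourier_coe_apply]
    congr 1
    simp [torusSection]
    ring
  change ∏ i, fourier ((-k) i) (τ i) = _
  rw [Finset.mul_sum, ← Finset.sum_neg_distrib, Complex.exp_sum]
  exact Finset.prod_congr rfl fun i _ => key i

lemma memLp_comp_torusSection {f : Plane → ℝ} (hf : MemLp f 2 (volume.restrict box)) :
    MemLp (fun τ => (f (torusSection τ) : ℂ)) 2 volume :=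
  ((hf.smul_measure ENNReal.ofReal_ne_top).comp_measurePreserving
    measurePreserving_torusSection).ofReal

lemma mFourierCoeff_toLp_comp_torusSection {f : Plane → ℝ}
    (hf : MemLp f 2 (volume.restrict box)) (k : Fin 2 → ℤ) :
    mFourierCoeff ((memLp_comp_torusSection hf).toLp _) k = fourierCoeffBox f k := by
  rw [fourierCoeffBox, ← integral_torusSection]
  refine integral_congr_ae ?_
  filter_upwards [(memLp_comp_torusSection hf).coeFn_toLp] with τ hτ
  rw [hτ, smul_eq_mul, mFourier_neg_apply, mul_comm]

/-- **Parseval's identity** on the period box. -/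
theorem hasSum_fourierCoeffBox {f g : Plane → ℝ} (hf : MemLp f 2 (volume.restrict box))
    (hg : MemLp g 2 (volume.restrict box)) :
    HasSum (fun k => conj (fourierCoeffBox f k) * fourierCoeffBox g k)
      ((1 / (2 * (Real.pi : ℂ)) ^ 2) * ((∫ x in box, f x * g x : ℝ) : ℂ)) := by
  have h := hasSum_prod_mFourierCoeff ((memLp_comp_torusSection hf).toLp _)
    ((memLp_comp_torusSection hg).toLp _)
  simp only [mFourierCoeff_toLp_comp_torusSection hf, mFourierCoeff_toLp_comp_torusSection hg] at h
  convert h using 1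
  rw [← integral_complex_ofReal, ← integral_torusSection]
  refine integral_congr_ae ?_
  filter_upwards [(memLp_comp_torusSection hf).coeFn_toLp,
    (memLp_comp_torusSection hg).coeFn_toLp] with τ hτ hτ'
  rw [hτ, hτ', Complex.conj_ofReal, Complex.ofReal_mul]

end Parseval

open ComplexConjugate

/-! ### The velocity field -/

lemma norm_rieszSymbol_le (j : Fin 2) (k : Fin 2 → ℤ) : ‖rieszSymbol j k‖ ≤ 1 := by
  unfold rieszSymbol
  split_ifs
  · simp
  · rw [norm_mul, norm_neg, Complex.norm_I, one_mul, norm_div, Complex.norm_intCast,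
      Complex.norm_real, Real.norm_of_nonneg (Real.sqrt_nonneg _)]
    refine div_le_one_of_le₀ (Real.le_sqrt_of_sq_le ?_) (Real.sqrt_nonneg _)
    rw [sq_abs]
    exact Finset.single_le_sum (f := fun i => (k i : ℝ) ^ 2) (fun i _ => sq_nonneg _)
      (Finset.mem_univ j)

/-- Riesz transforms do not increase the `L²` norm. -/
lemma IsRieszTransform.integral_sq_le {j : Fin 2} {f g : Plane → ℝ} (h : IsRieszTransform j f g)
    (hf : MemLp f 2 (volume.restrict box)) :
    ∫ x in box, g x ^ 2 ≤ ∫ x in box, f x ^ 2 := by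
  have key : ∀ {h : Plane → ℝ}, MemLp h 2 (volume.restrict box) →
      HasSum (fun k => ‖fourierCoeffBox h k‖ ^ 2) ((1 / (2 * Real.pi) ^ 2) * ∫ x in box, h x ^ 2) := by
    intro h hh
    have := hasSum_fourierCoeffBox hh hh
    simp_rw [← Complex.normSq_eq_conj_mul_self, Complex.normSq_eq_norm_sq, ← sq] at this
    exact_mod_cast this
  -- By Parseval, the inequality reduces to the bound 1 on the symbol at each frequency.
  have h2 := hasSum_le (fun k => ?_) (key h.memLp) (key hf)
  · exact le_of_mul_le_mul_left h2 (by positivity)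
  · rw [h.fourier, norm_mul]
    gcongr
    exact mul_le_of_le_one_left (norm_nonneg _) (norm_rieszSymbol_le j k)

lemma fourierCoeffBox_neg (f : Plane → ℝ) (k : Fin 2 → ℤ) :
    fourierCoeffBox (fun x => -f x) k = -fourierCoeffBox f k := by
  simp [fourierCoeffBox, integral_neg]

lemma _root_.Continuous.memLp_box {E : Type*} [NormedAddCommGroup E] {f : Plane → E} (hf : Continuous f)
    (p : ENNReal) : MemLp f p (volume.restrict box) := by
  obtain ⟨C, hC⟩ := isCompact_box.exists_bound_of_continuousOn hf.continuousOn
  exact MemLp.of_bound hf.aestronglyMeasurable.restrict C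
    ((ae_restrict_iff' measurableSet_box).2 (ae_of_all _ hC))

/-- The Fourier coefficients of a partial derivative. -/
lemma fourierCoeffBox_partialDeriv {η : Plane → ℝ} (hη : ContDiff ℝ 1 η) (hper : IsPeriodic η)
    (i : Fin 2) (k : Fin 2 → ℤ) :
    fourierCoeffBox (fun x => fderiv ℝ η x (EuclideanSpace.single i 1)) k =
      Complex.I * k i * fourierCoeffBox η k := by
  set e : Plane → ℂ := fun x => Complex.exp (-(Complex.I * ∑ i, (k i : ℂ) * (x i : ℂ)))
  set l : Plane →L[ℝ] ℂ := -(Complex.I • ∑ i, (k i : ℂ) • Complex.ofRealCLM.comp (EuclideanSpace.proj i))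
  have hl : ∀ x, l x = -(Complex.I * ∑ i, (k i : ℂ) * (x i : ℂ)) := by
    intro x; simp [l]; ring
  have he : ∀ x, HasFDerivAt e (e x • l) x := by
    intro x
    have := (l.hasFDerivAt (x := x)).cexp
    simpa only [hl] using this
  have hec : ContDiff ℝ 1 e := by
    have : e = fun x => Complex.exp (l x) := by ext x; simp [hl, e]
    rw [this]
    exact Complex.contDiff_exp.comp l.contDiff
  have heper : IsPeriodic e := by
    intro j x
    have : -(Complex.I * ∑ i, (k i : ℂ) * ((x + EuclideanSpace.single j (2 * Real.pi)) i : ℂ)) =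
        -(Complex.I * ∑ i, (k i : ℂ) * (x i : ℂ)) + ((-k j : ℤ) : ℂ) * (2 * Real.pi * Complex.I) := by
      fin_cases j <;> simp <;> ring
    simp only [e]
    rw [this, Complex.exp_add, Complex.exp_int_mul_two_pi_mul_I, mul_one]
  have hηc : ContDiff ℝ 1 (fun x => (η x : ℂ)) := Complex.ofRealCLM.contDiff.comp hη
  -- Integration by parts: the product with the exponential is periodic because `k` is integral, so
  -- its derivative has mean zero.
  have h0 := integral_box_partialDeriv_eq_zero (f := fun x => (η x : ℂ) * e x) (hηc.mul hec)
    (fun i x => by simp only [hper i x, heper i x]) i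
  have hd : ∀ x, fderiv ℝ (fun x => (η x : ℂ) * e x) x (EuclideanSpace.single i 1) =
      (fderiv ℝ η x (EuclideanSpace.single i 1) : ℂ) * e x - Complex.I * k i * ((η x : ℂ) * e x) := by
    intro x
    have h1 : HasFDerivAt (fun x => (η x : ℂ)) (Complex.ofRealCLM.comp (fderiv ℝ η x)) x :=
      Complex.ofRealCLM.hasFDerivAt.comp x ((hη.differentiable (by simp)) x).hasFDerivAt
    rw [(h1.fun_mul (he x)).fderiv]
    have : l (EuclideanSpace.single i 1) = -(Complex.I * k i) := by
      rw [hl]; fin_cases i <;> simp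
    simp [this]
    ring
  simp_rw [hd] at h0
  have hcd : Continuous fun x => fderiv ℝ η x (EuclideanSpace.single i 1) :=
    (hη.continuous_fderiv (by simp)).clm_apply continuous_const
  rw [integral_sub, integral_const_mul] at h0
  · simp only [fourierCoeffBox]
    rw [sub_eq_zero.1 h0]
    ring
  · exact memLp_one_iff_integrable.1
      (((Complex.continuous_ofReal.comp hcd).mul hec.continuous).memLp_box 1)
  · exact memLp_one_iff_integrable.1
      ((continuous_const.mul (hηc.continuous.mul hec.continuous)).memLp_box 1)

/-- The velocity field is weakly divergence free. -/
lemma IsVelocityOf.integral_inner_gradient {f : Plane → ℝ} {v : Plane → Plane}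
    (h : IsVelocityOf f v) {η : Plane → ℝ} (hη : ContDiff ℝ 1 η) (hper : IsPeriodic η) :
    ∫ x in box, v x 0 * fderiv ℝ η x (EuclideanSpace.single 0 1) +
      v x 1 * fderiv ℝ η x (EuclideanSpace.single 1 1) = 0 := by
  have hcd : ∀ i : Fin 2, Continuous fun x => fderiv ℝ η x (EuclideanSpace.single i 1) :=
    fun i => (hη.continuous_fderiv (by simp)).clm_apply continuous_const
  have h0 : MemLp (fun x => v x 0) 2 (volume.restrict box) := by
    simpa [Pi.neg_def] using h.1.memLp.neg
  have h1 : MemLp (fun x => v x 1) 2 (volume.restrict box) := h.2.memLp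
  have hp := (hasSum_fourierCoeffBox ((hcd 0).memLp_box 2) h0).add
    (hasSum_fourierCoeffBox ((hcd 1).memLp_box 2) h1)
  -- Under Parseval the integral becomes a sum over frequencies. The coefficient vector of `v` is a
  -- multiple of `(k₁, -k₀)` and that of `∇η` a multiple of `(k₀, k₁)`, so every term vanishes.
  have hz : ∀ k, conj (fourierCoeffBox (fun x => fderiv ℝ η x (EuclideanSpace.single 0 1)) k)
      * fourierCoeffBox (fun x => v x 0) k +
      conj (fourierCoeffBox (fun x => fderiv ℝ η x (EuclideanSpace.single 1 1)) k)
      * fourierCoeffBox (fun x => v x 1) k = 0 := by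
    intro k
    have e0 : fourierCoeffBox (fun x => v x 0) k = -(rieszSymbol 1 k * fourierCoeffBox f k) := by
      rw [← h.1.fourier, fourierCoeffBox_neg, neg_neg]
    rw [e0, h.2.fourier, fourierCoeffBox_partialDeriv hη hper, fourierCoeffBox_partialDeriv hη hper]
    unfold rieszSymbol
    split_ifs
    · simp
    · simp
      ring
  simp only [hz] at hp
  have := hp.unique hasSum_zero
  rw [← mul_add, mul_eq_zero, or_iff_right (by simp [Real.pi_ne_zero])] at this
  rw [integral_add]
  · simp_rw [mul_comm (v _ _)]
    exact Complex.ofReal_injective (by push_cast; exact this)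
  · exact h0.integrable_mul ((hcd 0).memLp_box 2)
  · exact h1.integrable_mul ((hcd 1).memLp_box 2)

/-- The velocity is controlled in `L²` by the scalar. -/
lemma IsVelocityOf.eLpNorm_le {f : Plane → ℝ} {v : Plane → Plane} (h : IsVelocityOf f v)
    (hf : MemLp f 2 (volume.restrict box)) (hv : AEStronglyMeasurable v (volume.restrict box)) :
    eLpNorm v 2 (volume.restrict box) ≤ 2 * eLpNorm f 2 (volume.restrict box) := by
  have key : ∀ {j : Fin 2} {g : Plane → ℝ}, IsRieszTransform j f g →
      eLpNorm g 2 (volume.restrict box) ≤ eLpNorm f 2 (volume.restrict box) := by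
    intro j g hg
    rw [hg.memLp.eLpNorm_eq_integral_rpow_norm (by simp) (by simp),
      hf.eLpNorm_eq_integral_rpow_norm (by simp) (by simp)]
    simp only [ENNReal.toReal_ofNat, Real.rpow_ofNat, Real.norm_eq_abs, sq_abs]
    exact ENNReal.ofReal_le_ofReal (Real.rpow_le_rpow (integral_nonneg fun x => sq_nonneg _)
      (hg.integral_sq_le hf) (by norm_num))
  have hm : ∀ i : Fin 2, AEStronglyMeasurable (fun x => v x i) (volume.restrict box) := fun i =>
    (EuclideanSpace.proj (𝕜 := ℝ) i).continuous.comp_aestronglyMeasurable hv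
  -- The factor 2 comes from `|v| ≤ |v₀| + |v₁|`, each component being a Riesz transform up to sign.
  calc eLpNorm v 2 (volume.restrict box)
      ≤ eLpNorm ((fun x => ‖-(v x 0)‖) + fun x => ‖v x 1‖) 2 (volume.restrict box) := by
        refine eLpNorm_mono_real fun x => ?_
        rw [EuclideanSpace.norm_eq, Fin.sum_univ_two]
        refine Real.sqrt_le_iff.2 ⟨add_nonneg (norm_nonneg _) (norm_nonneg _), ?_⟩
        simp only [Pi.add_apply, norm_neg]
        nlinarith [norm_nonneg (v x 0), norm_nonneg (v x 1)]
    _ ≤ eLpNorm (fun x => ‖-(v x 0)‖) 2 (volume.restrict box) +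
        eLpNorm (fun x => ‖v x 1‖) 2 (volume.restrict box) :=
        eLpNorm_add_le (hm 0).neg.norm (hm 1).norm (by norm_num)
    _ ≤ 2 * eLpNorm f 2 (volume.restrict box) := by
        rw [eLpNorm_norm, eLpNorm_norm, two_mul]
        exact add_le_add (key h.1) (key h.2)

/-! ### The chain rule for weak derivatives in time -/

/-- Smooth functions supported in a compact subinterval of `(0, T)`. -/
def IsTimeTest (T : ℝ) (χ : ℝ → ℝ) : Prop :=
  ContDiff ℝ ∞ χ ∧ ∃ a b, 0 < a ∧ a ≤ b ∧ b < T ∧ ∀ t ∉ Icc a b, χ t = 0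

lemma exists_Icc_of_isCompact {T : ℝ} (hT : 0 < T) {K : Set ℝ} (hK : IsCompact K)
    (hKT : K ⊆ Ioo 0 T) : ∃ a b, 0 < a ∧ a ≤ b ∧ b < T ∧ K ⊆ Icc a b := by
  rcases K.eq_empty_or_nonempty with rfl | hne
  · exact ⟨T / 2, T / 2, by linarith, le_rfl, by linarith, empty_subset _⟩
  · obtain ⟨a, ha⟩ := hK.exists_isLeast hne
    obtain ⟨b, hb⟩ := hK.exists_isGreatest hne
    exact ⟨a, b, (hKT ha.1).1, ha.2 hb.1, (hKT hb.1).2, fun x hx => ⟨ha.2 hx, hb.2 hx⟩⟩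

lemma setIntegral_Ioo_eq_intervalIntegral {T : ℝ} (hT : 0 ≤ T) (f : ℝ → ℝ) :
    ∫ t in Ioo 0 T, f t = ∫ t in 0..T, f t := by
  rw [intervalIntegral.integral_of_le hT, integral_Ioc_eq_integral_Ioo]

lemma IsTimeTest.boundary_eq_zero {T : ℝ} {χ : ℝ → ℝ} (h : IsTimeTest T χ) :
    χ 0 = 0 ∧ χ T = 0 := by
  obtain ⟨-, a, b, ha, hab, hb, h0⟩ := h
  exact ⟨h0 _ fun h => by linarith [h.1], h0 _ fun h => by linarith [h.2]⟩

lemma IsTimeTest.absolutelyContinuous {T : ℝ} {χ : ℝ → ℝ} (h : IsTimeTest T χ) :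
    AbsolutelyContinuousOnInterval χ 0 T :=
  (h.1.of_le (by simp)).contDiffOn.absolutelyContinuousOnInterval

/-- The total increment over a family of intervals grows at most by the factor `C`. This lets
integration by parts in time be applied to `G(θ_ε)`. -/
lemma _root_.LipschitzWith.comp_absolutelyContinuousOnInterval {G f : ℝ → ℝ} {C : NNReal} {a b : ℝ}
    (hG : LipschitzWith C G) (hf : AbsolutelyContinuousOnInterval f a b) :
    AbsolutelyContinuousOnInterval (fun t => G (f t)) a b := by
  refine squeeze_zero (fun E => Finset.sum_nonneg fun _ _ => dist_nonneg) (fun E => ?_)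
    (by simpa using Tendsto.const_mul (C : ℝ) hf)
  rw [Finset.mul_sum]
  exact Finset.sum_le_sum fun i _ => hG.dist_le_mul _ _

/-- Integration by parts against a test function. -/
lemma IsTimeTest.integral_mul_deriv {T : ℝ} {χ f : ℝ → ℝ} (h : IsTimeTest T χ)
    (hf : AbsolutelyContinuousOnInterval f 0 T) :
    ∫ t in 0..T, f t * deriv χ t = -∫ t in 0..T, deriv f t * χ t := by
  rw [hf.integral_mul_deriv_eq_deriv_mul h.absolutelyContinuous, h.boundary_eq_zero.1,
    h.boundary_eq_zero.2]
  simp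

/-- The du Bois-Reymond lemma: a function with vanishing weak derivative is constant. -/
lemma exists_ae_eq_const_of_integral_mul_deriv {T : ℝ} (hT : 0 < T) {f : ℝ → ℝ}
    (hf : IntegrableOn f (Ioo 0 T))
    (h : ∀ χ, IsTimeTest T χ → ∫ t in 0..T, f t * deriv χ t = 0) :
    ∃ c, ∀ᵐ t, t ∈ Ioo 0 T → f t = c := by
  have hfi : IntervalIntegrable f volume 0 T :=
    (intervalIntegrable_iff_integrableOn_Ioo_of_le hT.le).2 hf
  -- A reference bump of integral one, supported in `[T/4, 3T/4]`. The constant in the conclusion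
  -- will be the average of `f` against it.
  let B : ContDiffBump (T / 2) := ⟨T / 8, T / 4, by linarith, by linarith⟩
  set η₀ : ℝ → ℝ := B.normed volume
  have hη₀ : ContDiff ℝ ∞ η₀ := B.contDiff_normed
  have hη₀s : ∀ t ∉ Icc (T / 4) (3 * T / 4), η₀ t = 0 := by
    intro t ht
    have : t ∉ Function.support η₀ := by
      rw [B.support_normed_eq, Real.ball_eq_Ioo]
      have hB : B.rOut = T / 4 := rfl
      exact fun h => ht ⟨by linarith [h.1], by linarith [h.2]⟩
    simpa using this
  have hη₀T : ∀ s t, s < T / 4 → 3 * T / 4 < t → ∫ x in s..t, η₀ x = 1 := by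
    intro s t hs ht
    rw [intervalIntegral.integral_eq_integral_of_support_subset, B.integral_normed]
    intro x hx
    by_contra hx'
    exact hx (hη₀s x fun h => hx' ⟨by linarith [h.1], by linarith [h.2]⟩)
  refine ⟨∫ t in 0..T, f t * η₀ t, ?_⟩
  set c := ∫ t in 0..T, f t * η₀ t
  have := isOpen_Ioo.ae_eq_zero_of_integral_contDiff_smul_eq_zero
    (f := fun t => f t - c) (U := Ioo 0 T) (μ := volume) ?_ ?_
  · filter_upwards [this] with t ht h using sub_eq_zero.1 (ht h)
  · exact (hf.sub (integrableOn_const (by simp))).locallyIntegrableOn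
  intro η hη hηc hηs
  obtain ⟨a, b, ha, hab, hb, hKab⟩ := exists_Icc_of_isCompact hT hηc.isCompact hηs
  have hη0 : ∀ t ∉ Icc a b, η t = 0 := fun t ht =>
    image_eq_zero_of_notMem_tsupport fun h => ht (hKab h)
  set m := ∫ t in 0..T, η t
  -- Subtracting the right multiple of the bump gives integral zero, so the primitive from 0
  -- vanishes near both ends and is an admissible test function whose derivative is `ζ`.
  set ζ : ℝ → ℝ := fun t => η t - m * η₀ t
  have hζc : ContDiff ℝ ∞ ζ := hη.sub (contDiff_const.mul hη₀)
  have hζ0 : ∀ t ∉ Icc (min a (T / 4)) (max b (3 * T / 4)), ζ t = 0 := by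
    intro t ht
    have h1 : t ∉ Icc a b := fun h => ht ⟨(min_le_left _ _).trans h.1, h.2.trans (le_max_left _ _)⟩
    have h2 : t ∉ Icc (T / 4) (3 * T / 4) := fun h =>
      ht ⟨(min_le_right _ _).trans h.1, h.2.trans (le_max_right _ _)⟩
    simp [ζ, hη0 t h1, hη₀s t h2]
  have hmin : 0 < min a (T / 4) := lt_min ha (by linarith)
  have hmax : max b (3 * T / 4) < T := max_lt hb (by linarith)
  have hderiv : ∀ t, HasDerivAt (fun t => ∫ s in 0..t, ζ s) (ζ t) t := fun t =>
    hζc.continuous.integral_hasStrictDerivAt 0 t |>.hasDerivAt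
  have hχ : IsTimeTest T (fun t => ∫ s in 0..t, ζ s) := by
    refine ⟨contDiff_infty_iff_deriv.2 ⟨fun t => (hderiv t).differentiableAt, ?_⟩,
      min a (T / 4), max b (3 * T / 4), hmin,
      (min_le_left _ _).trans (hab.trans (le_max_left _ _)), hmax, ?_⟩
    · rw [funext fun t => (hderiv t).deriv]
      exact hζc
    · intro t ht
      beta_reduce
      by_cases h1 : t < min a (T / 4)
      · rw [intervalIntegral.integral_congr (g := fun _ => (0 : ℝ)), intervalIntegral.integral_zero]
        intro s hs
        refine hζ0 s fun h => ?_
        rcases le_total 0 t with h' | h'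
        · rw [uIcc_of_le h'] at hs; linarith [hs.2, h.1]
        · rw [uIcc_of_ge h'] at hs; linarith [hs.2, h.1]
      · have h2 : max b (3 * T / 4) < t := by
          by_contra h2
          exact ht ⟨not_lt.1 h1, not_lt.1 h2⟩
        have hi : ∀ {g : ℝ → ℝ}, Continuous g → ∀ x y, IntervalIntegrable g volume x y :=
          fun hg x y => hg.intervalIntegrable x y
        have e1 : ∫ s in 0..t, η s = m := by
          rw [← intervalIntegral.integral_add_adjacent_intervals (b := T) (hi hη.continuous _ _)
            (hi hη.continuous _ _), add_eq_left]
          rw [intervalIntegral.integral_congr (g := fun _ => (0 : ℝ)),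
            intervalIntegral.integral_zero]
          intro s hs
          refine hη0 s fun h => ?_
          have h3 := (le_max_left b (3 * T / 4)).trans_lt h2
          rcases le_total T t with h' | h'
          · rw [uIcc_of_le h'] at hs; linarith [hs.1, h.2]
          · rw [uIcc_of_ge h'] at hs; linarith [hs.1, h.2]
        have e2 := hη₀T 0 t (by linarith) ((le_max_right _ _).trans_lt h2)
        simp only [ζ]
        rw [intervalIntegral.integral_sub (hi hη.continuous _ _)
          ((hi hη₀.continuous _ _).const_mul m), intervalIntegral.integral_const_mul, e1,
          e2, mul_one, sub_self]
  have hχ0 := h _ hχ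
  simp only [(hderiv _).deriv, ζ] at hχ0
  have i1 : IntervalIntegrable (fun t => f t * η t) volume 0 T :=
    hfi.mul_continuousOn hη.continuous.continuousOn
  have i2 : IntervalIntegrable (fun t => f t * η₀ t) volume 0 T :=
    hfi.mul_continuousOn hη₀.continuous.continuousOn
  have e : ∫ t in 0..T, f t * η t = m * c := by
    have : (fun t => f t * (η t - m * η₀ t)) = fun t => f t * η t - m * (f t * η₀ t) := by
      ext; ring
    rw [this, intervalIntegral.integral_sub i1 (i2.const_mul m),
      intervalIntegral.integral_const_mul] at hχ0
    linarith
  have hfull : ∫ t, η t • (f t - c) = ∫ t in 0..T, η t • (f t - c) := by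
    refine (intervalIntegral.integral_eq_integral_of_support_subset fun x hx => ?_).symm
    by_contra hx'
    refine hx ?_
    simp only [hη0 x fun h => hx' ⟨by linarith [h.1], by linarith [h.2]⟩, zero_smul]
  rw [hfull]
  have : (fun t => η t • (f t - c)) = fun t => f t * η t - c * η t := by
    ext; rw [smul_eq_mul]; ring
  rw [this, intervalIntegral.integral_sub i1 ((hη.continuous.intervalIntegrable _ _).const_mul c),
    intervalIntegral.integral_const_mul, e]
  ring

/-- The chain rule: if `f' = g` weakly on `(0, T)`, then `(G ∘ f)' = G'(f) g` weakly. -/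
theorem integral_comp_mul_deriv_of_weakDeriv {T : ℝ} (hT : 0 < T) {f g : ℝ → ℝ}
    (hf : IntegrableOn f (Ioo 0 T)) (hg : IntegrableOn g (Ioo 0 T))
    (h : ∀ χ, IsTimeTest T χ →
      ∫ t in Ioo 0 T, f t * deriv χ t = -∫ t in Ioo 0 T, g t * χ t)
    {G : ℝ → ℝ} {C : NNReal} (hG : Differentiable ℝ G) (hGL : LipschitzWith C G)
    {χ : ℝ → ℝ} (hχ : IsTimeTest T χ) :
    ∫ t in Ioo 0 T, G (f t) * deriv χ t = -∫ t in Ioo 0 T, deriv G (f t) * g t * χ t := by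
  simp only [setIntegral_Ioo_eq_intervalIntegral hT.le] at h ⊢
  have hfi : IntervalIntegrable f volume 0 T :=
    (intervalIntegrable_iff_integrableOn_Ioo_of_le hT.le).2 hf
  have hgi : IntervalIntegrable g volume 0 T :=
    (intervalIntegrable_iff_integrableOn_Ioo_of_le hT.le).2 hg
  -- The primitive is absolutely continuous with derivative `g` almost everywhere, so `f - H` has
  -- zero weak derivative. Thus `f = H + c` a.e., and the classical chain rule applies to `G(H +
  -- c)`.
  set H : ℝ → ℝ := fun t => ∫ s in 0..t, g s
  have hH : AbsolutelyContinuousOnInterval H 0 T :=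
    hgi.absolutelyContinuousOnInterval_intervalIntegral left_mem_uIcc
  have hHd : ∀ᵐ t, t ∈ uIcc 0 T → HasDerivAt H (g t) t := by
    filter_upwards [hgi.ae_hasDerivAt_integral] with t ht h using ht h 0 left_mem_uIcc
  have hHi : IntervalIntegrable H volume 0 T := hH.continuousOn.intervalIntegrable
  obtain ⟨c, hc⟩ := exists_ae_eq_const_of_integral_mul_deriv hT (f := fun t => f t - H t)
    (hf.sub ((intervalIntegrable_iff_integrableOn_Ioo_of_le hT.le).1 hHi)) fun χ hχ => by
      have hd : Continuous (deriv χ) := hχ.1.continuous_deriv (by simp)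
      simp only [sub_mul]
      rw [intervalIntegral.integral_sub (hfi.mul_continuousOn hd.continuousOn)
        (hHi.mul_continuousOn hd.continuousOn), h χ hχ, hχ.integral_mul_deriv hH, sub_eq_zero]
      congr 1
      refine intervalIntegral.integral_congr_ae ?_
      filter_upwards [hHd] with t ht h'
      rw [(ht (uIoc_subset_uIcc h')).deriv]
  have hfc : ∀ᵐ t, t ∈ uIoc 0 T → f t = H t + c := by
    have hT' : ∀ᵐ t : ℝ, t ≠ T := by simp [ae_iff, measure_singleton]
    filter_upwards [hc, hT'] with t ht ht' h
    rw [uIoc_of_le hT.le] at h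
    linarith [ht ⟨h.1, h.2.lt_of_ne ht'⟩]
  have hHc : AbsolutelyContinuousOnInterval (fun t => H t + c) 0 T :=
    hH.add (f := H) (g := fun _ => c) (contDiff_const (n := 1)).contDiffOn.absolutelyContinuousOnInterval
  have hGH := hGL.comp_absolutelyContinuousOnInterval hHc
  have key := hχ.integral_mul_deriv hGH
  rw [intervalIntegral.integral_congr_ae (g := fun t => G (H t + c) * deriv χ t), key]
  · congr 1
    refine intervalIntegral.integral_congr_ae ?_
    filter_upwards [hHd, hfc] with t ht hft h'
    have h1 : HasDerivAt (fun t => G (H t + c)) (deriv G (H t + c) * g t) t :=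
      (hG _).hasDerivAt.comp t ((ht (uIoc_subset_uIcc h')).add_const c)
    rw [h1.deriv, hft h']
  · filter_upwards [hfc] with t hft h'
    rw [hft h']

/-! ### Convergence of mollifications in `L^p` -/

/-- Translation is continuous in `L^p`. -/
lemma tendsto_eLpNorm_translate_sub {E : Type*} [NormedAddCommGroup E] {p : ENNReal} (hp1 : 1 ≤ p)
    (hp : p ≠ ⊤) {g : ℝ × Plane → E} (hg : MemLp g p volume) :
    Tendsto (fun h : ℝ × Plane => eLpNorm (fun z => g (z - h) - g z) p volume) (𝓝 0) (𝓝 0) := by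
  have : Fact (1 ≤ p) := ⟨hp1⟩
  have : Fact (p ≠ ⊤) := ⟨hp⟩
  have : VAddInvariantMeasure (ℝ × Plane) (ℝ × Plane) volume :=
    inferInstanceAs (VAddInvariantMeasure (ℝ × Plane) (ℝ × Plane) (volume.prod volume))
  have hmem : ∀ h : ℝ × Plane, MemLp (fun z => g (-h +ᵥ z)) p volume := fun h =>
    hg.comp_measurePreserving (measurePreserving_vadd (-h) volume)
  -- Translation is read as an additive action on `Lp`, which is continuous for finite `p`.
  have hc : Continuous fun h : ℝ × Plane => DomAddAct.mk (-h) +ᵥ hg.toLp g :=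
    (DomAddAct.continuous_mk.comp continuous_neg).vadd continuous_const
  have h0 := hc.tendsto 0
  have hzero : DomAddAct.mk (-(0 : ℝ × Plane)) +ᵥ hg.toLp g = hg.toLp g := by
    rw [neg_zero, DomAddAct.mk_zero, zero_vadd]
  rw [hzero] at h0
  have h1 := (Lp.tendsto_Lp_iff_tendsto_eLpNorm'' (fun (h z : ℝ × Plane) => g (-h +ᵥ z)) hmem g hg).1
    (by simpa only [DomAddAct.mk_vadd_toLp] using h0)
  refine h1.congr fun h => ?_
  congr 1
  ext z
  simp [sub_eq_neg_add]

/-- A form of Minkowski's inequality for averages of translates. -/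
lemma eLpNorm_average_translate_sub_le {E : Type*} [NormedAddCommGroup E] [NormedSpace ℝ E]
    [CompleteSpace E] {p : ENNReal} (hp1 : 1 ≤ p) (hp : p ≠ ⊤) {g : ℝ × Plane → E}
    (hg : StronglyMeasurable g) {K : Plane → ℝ} (hK : Continuous K) (hKc : HasCompactSupport K)
    (hK0 : ∀ y, 0 ≤ K y) (hK1 : ∫ y, K y = 1) {δ : ENNReal}
    (hδ : ∀ y, K y ≠ 0 → eLpNorm (fun z : ℝ × Plane => g (z - (0, y)) - g z) p volume ≤ δ) :
    eLpNorm (fun z : ℝ × Plane => (∫ y, K y • g (z - (0, y))) - g z) p volume ≤ δ := by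
  have hp0 : p ≠ 0 := (zero_lt_one.trans_le hp1).ne'
  have hpr : 0 < p.toReal := ENNReal.toReal_pos hp0 hp
  have hKi : Integrable K := hK.integrable_of_hasCompactSupport hKc
  have hKm : Measurable fun y => ENNReal.ofReal (K y) := hK.measurable.ennreal_ofReal
  -- The kernel is the density of a probability measure, so the `L¹(ν)` norm is at most the `L^p(ν)`
  -- norm. Raising this to the power `p` and exchanging integrals by Tonelli gives the bound.
  set ν : Measure Plane := volume.withDensity fun y => ENNReal.ofReal (K y)
  have : IsProbabilityMeasure ν := ⟨by
    rw [withDensity_apply _ MeasurableSet.univ, setLIntegral_univ,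
      ← ofReal_integral_eq_lintegral_ofReal hKi (ae_of_all _ hK0), hK1, ENNReal.ofReal_one]⟩
  have hd : StronglyMeasurable (Function.uncurry fun (z : ℝ × Plane) (y : Plane) =>
      g (z - (0, y)) - g z) := by
    refine (hg.comp_measurable ?_).sub (hg.comp_measurable measurable_fst)
    exact measurable_fst.sub (measurable_const.prodMk measurable_snd)
  have hdz : ∀ z, StronglyMeasurable fun y => g (z - (0, y)) - g z := fun z =>
    hd.comp_measurable measurable_prodMk_left
  have hpt : ∀ z : ℝ × Plane, ‖(∫ y, K y • g (z - (0, y))) - g z‖ₑ ^ p.toReal ≤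
      ∫⁻ y, ‖g (z - (0, y)) - g z‖ₑ ^ p.toReal ∂ν := by
    intro z
    have h1 : ‖(∫ y, K y • g (z - (0, y))) - g z‖ₑ ≤ eLpNorm (fun y => g (z - (0, y)) - g z) 1 ν := by
      have e1 : eLpNorm (fun y => g (z - (0, y)) - g z) 1 ν =
          ∫⁻ y, ‖K y • (g (z - (0, y)) - g z)‖ₑ := by
        rw [eLpNorm_one_eq_lintegral_enorm, lintegral_withDensity_eq_lintegral_mul₀
          hKm.aemeasurable (hdz z).enorm.aemeasurable]
        refine lintegral_congr fun y => ?_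
        rw [Pi.mul_apply, enorm_smul, Real.enorm_eq_ofReal (hK0 y)]
      -- An infinite right side is harmless; otherwise the integrand is integrable and `g z`, being
      -- averaged with total mass one, can be moved inside.
      by_cases htop : eLpNorm (fun y => g (z - (0, y)) - g z) 1 ν = ⊤
      · rw [htop]; exact le_top
      have hi : Integrable fun y => K y • (g (z - (0, y)) - g z) :=
        ⟨hK.aestronglyMeasurable.smul (hdz z).aestronglyMeasurable, by
          rw [HasFiniteIntegral, ← e1]; exact lt_top_iff_ne_top.2 htop⟩
      have e2 : (∫ y, K y • g (z - (0, y))) - g z = ∫ y, K y • (g (z - (0, y)) - g z) := by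
        have hic : Integrable fun y => K y • g z := hKi.smul_const _
        have : (fun y => K y • g (z - (0, y))) =
            fun y => K y • (g (z - (0, y)) - g z) + K y • g z := by
          ext y; rw [smul_sub, sub_add_cancel]
        rw [this, integral_add hi hic, integral_smul_const, hK1, one_smul, add_sub_cancel_right]
      rw [e2, e1]
      exact enorm_integral_le_lintegral_enorm _
    have h2 := h1.trans (eLpNorm_le_eLpNorm_of_exponent_le hp1 (hdz z).aestronglyMeasurable)
    rw [eLpNorm_eq_lintegral_rpow_enorm_toReal hp0 hp] at h2
    calc _ ≤ ((∫⁻ y, ‖g (z - (0, y)) - g z‖ₑ ^ p.toReal ∂ν) ^ (1 / p.toReal)) ^ p.toReal := by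
          gcongr
      _ = _ := by rw [← ENNReal.rpow_mul, one_div_mul_cancel hpr.ne', ENNReal.rpow_one]
  have hmeas : Measurable (Function.uncurry fun (z : ℝ × Plane) (y : Plane) =>
      ‖g (z - (0, y)) - g z‖ₑ ^ p.toReal) := hd.enorm.pow_const _
  have hswap : ∫⁻ z, ‖(∫ y, K y • g (z - (0, y))) - g z‖ₑ ^ p.toReal ≤ δ ^ p.toReal := by
    calc _ ≤ ∫⁻ z : ℝ × Plane, ∫⁻ y, ‖g (z - (0, y)) - g z‖ₑ ^ p.toReal ∂ν := lintegral_mono hpt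
      _ = ∫⁻ y, (∫⁻ z : ℝ × Plane, ‖g (z - (0, y)) - g z‖ₑ ^ p.toReal) ∂ν :=
        lintegral_lintegral_swap hmeas.aemeasurable
      _ = ∫⁻ y, ENNReal.ofReal (K y) * ∫⁻ z : ℝ × Plane, ‖g (z - (0, y)) - g z‖ₑ ^ p.toReal := by
        rw [lintegral_withDensity_eq_lintegral_mul₀ hKm.aemeasurable
          hmeas.lintegral_prod_left.aemeasurable]
        rfl
      _ ≤ ∫⁻ y, ENNReal.ofReal (K y) * δ ^ p.toReal := by
        refine lintegral_mono fun y => ?_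
        by_cases hy : K y = 0
        · simp [hy]
        have := hδ y hy
        rw [eLpNorm_eq_lintegral_rpow_enorm_toReal hp0 hp] at this
        gcongr
        calc _ = ((∫⁻ z : ℝ × Plane, ‖g (z - (0, y)) - g z‖ₑ ^ p.toReal) ^ (1 / p.toReal)) ^
              p.toReal := by rw [← ENNReal.rpow_mul, one_div_mul_cancel hpr.ne', ENNReal.rpow_one]
          _ ≤ _ := by gcongr
      _ = δ ^ p.toReal := by
        rw [lintegral_mul_const _ hKm, ← ofReal_integral_eq_lintegral_ofReal hKi (ae_of_all _ hK0),
          hK1, ENNReal.ofReal_one, one_mul]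
  rw [eLpNorm_eq_lintegral_rpow_enorm_toReal hp0 hp]
  calc _ ≤ (δ ^ p.toReal) ^ (1 / p.toReal) := by gcongr
    _ = δ := by rw [← ENNReal.rpow_mul, mul_one_div_cancel hpr.ne', ENNReal.rpow_one]

/-! ### Convolution of a smooth kernel with a locally integrable function -/

/-- The convolution of a real kernel with a vector valued function on the plane. -/
noncomputable def conv {E : Type*} [NormedAddCommGroup E] [NormedSpace ℝ E] (K : Plane → ℝ)
    (f : Plane → E) : Plane → E :=
  convolution K f (ContinuousLinearMap.lsmul ℝ ℝ) volume

section conv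

variable {E : Type*} [NormedAddCommGroup E] [NormedSpace ℝ E]

lemma conv_apply (K : Plane → ℝ) (f : Plane → E) (x : Plane) :
    conv K f x = ∫ y, K y • f (x - y) := rfl

lemma conv_apply' (K : Plane → ℝ) (f : Plane → E) (x : Plane) :
    conv K f x = ∫ y, K (x - y) • f y := convolution_lsmul_swap

/-- Smooth compactly supported kernels. -/
structure IsKernel (K : Plane → ℝ) : Prop where
  contDiff : ContDiff ℝ ∞ K
  compactSupport : HasCompactSupport K

/-- Kernels carry no sign or mass condition, so derivatives of mollifiers qualify and every bound on
`conv` also covers derivatives of mollified functions. -/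
lemma IsKernel.partialDeriv {K : Plane → ℝ} (hK : IsKernel K) (v : Plane) :
    IsKernel fun x => fderiv ℝ K x v :=
  ⟨(hK.contDiff.fderiv_right (m := ∞) (by simp)).clm_apply contDiff_const,
    hK.compactSupport.fderiv_apply (𝕜 := ℝ) v⟩

/-- The reflected and translated kernel `y ↦ K (x - y)`. -/
lemma IsKernel.reflect {K : Plane → ℝ} (hK : IsKernel K) (x : Plane) :
    IsKernel fun y => K (x - y) :=
  ⟨hK.contDiff.comp (contDiff_const.sub contDiff_id),
    hK.compactSupport.comp_homeomorph (Homeomorph.subLeft x)⟩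

lemma IsKernel.integrable_smul {K : Plane → ℝ} (hK : IsKernel K) {f : Plane → E}
    (hf : LocallyIntegrable f) (x : Plane) : Integrable fun y => K y • f (x - y) :=
  hK.compactSupport.convolutionExists_left (ContinuousLinearMap.lsmul ℝ ℝ)
    hK.contDiff.continuous hf x

lemma IsKernel.contDiff_conv [CompleteSpace E] {K : Plane → ℝ} (hK : IsKernel K) {f : Plane → E}
    (hf : LocallyIntegrable f) : ContDiff ℝ ∞ (conv K f) :=
  hK.compactSupport.contDiff_convolution_left _ hK.contDiff hf

lemma IsKernel.fderiv_conv [CompleteSpace E] {K : Plane → ℝ} (hK : IsKernel K) {f : Plane → E}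
    (hf : LocallyIntegrable f) (x v : Plane) :
    fderiv ℝ (conv K f) x v = conv (fun y => fderiv ℝ K y v) f x := by
  have h := hK.compactSupport.hasFDerivAt_convolution_left (ContinuousLinearMap.lsmul ℝ ℝ)
    (hK.contDiff.of_le (by simp)) hf x
  change HasFDerivAt (conv K f) _ x at h
  have hint := (hK.compactSupport.fderiv ℝ).convolutionExists_left
    ((ContinuousLinearMap.lsmul ℝ ℝ : ℝ →L[ℝ] E →L[ℝ] E).precompL Plane)
    (hK.contDiff.continuous_fderiv (by simp)) hf x
  rw [h.fderiv, convolution_def, ContinuousLinearMap.integral_apply hint]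
  rfl

lemma conv_isPeriodic (K : Plane → ℝ) {f : Plane → E} (hf : IsPeriodic f) :
    IsPeriodic (conv K f) := by
  intro i x
  simp only [conv_apply]
  congr 1
  ext y
  rw [add_sub_right_comm, hf]

lemma IsKernel.conv_coord {K : Plane → ℝ} (hK : IsKernel K) {f : Plane → Plane}
    (hf : LocallyIntegrable f) (x : Plane) (i : Fin 2) :
    conv K f x i = conv K (fun y => f y i) x := by
  have := (EuclideanSpace.proj (𝕜 := ℝ) i).integral_comp_comm (hK.integrable_smul hf x)
  simp only [conv_apply]
  simpa using this.symm

end conv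

/-! ### Families bounded in `L^p` uniformly in time -/

/-- `f ∈ L^∞([0, T]; L^p(Ω))`, for a function `f(t, x)` periodic in `x`. -/
structure BoundedFamily {E : Type} [NormedAddCommGroup E] (T : ℝ) (p : ENNReal)
    (f : ℝ → Plane → E) : Prop where
  periodic : ∀ t, IsPeriodic (f t)
  aestronglyMeasurable : AEStronglyMeasurable (fun z : ℝ × Plane => f z.1 z.2)
    (volume.restrict (Ioo 0 T ×ˢ univ))
  bound : ∃ C : NNReal, ∀ᵐ t ∂(volume.restrict (Ioo 0 T)),
    eLpNorm (f t) p (volume.restrict box) ≤ C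

lemma restrict_prod_eq (s : Set ℝ) (t : Set Plane) :
    (volume.restrict (s ×ˢ t) : Measure (ℝ × Plane)) =
      (volume.restrict s).prod (volume.restrict t) := by
  rw [Measure.prod_restrict, Measure.volume_eq_prod]

lemma restrict_slab (T : ℝ) : (volume.restrict (slab T) : Measure (ℝ × Plane)) =
    (volume.restrict (Ioo 0 T)).prod (volume.restrict box) := restrict_prod_eq _ _

lemma measurableSet_slab (T : ℝ) : MeasurableSet (slab T) :=
  measurableSet_Ioo.prod measurableSet_box

instance (T : ℝ) : IsFiniteMeasure (volume.restrict (slab T)) := by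
  rw [restrict_slab]; infer_instance

/-- A property of almost every time holds at almost every point of the slab. -/
lemma ae_slab_of_ae_time {T : ℝ} {P : ℝ → Prop} (h : ∀ᵐ t ∂(volume.restrict (Ioo 0 T)), P t) :
    ∀ᵐ z ∂(volume.restrict (slab T)), P z.1 := by
  rw [restrict_slab]
  exact Measure.quasiMeasurePreserving_fst.ae h

lemma ae_mem_slab (T : ℝ) : ∀ᵐ z ∂(volume.restrict (slab T)), z.1 ∈ Ioo 0 T ∧ z.2 ∈ box :=
  (ae_restrict_mem (measurableSet_slab T)).mono fun _ hz => hz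

namespace BoundedFamily

variable {E : Type} [NormedAddCommGroup E] {T : ℝ} {p : ENNReal} {f : ℝ → Plane → E}

lemma ae_aestronglyMeasurable (hf : BoundedFamily T p f) :
    ∀ᵐ t ∂(volume.restrict (Ioo 0 T)), AEStronglyMeasurable (f t) volume := by
  have := hf.aestronglyMeasurable
  rw [restrict_prod_eq, Measure.restrict_univ] at this
  exact this.prodMk_left

lemma exists_bound_closedBall (hf : BoundedFamily T p f) (hp0 : p ≠ 0) (hp : p ≠ ⊤) (R : ℝ) :
    ∃ C : NNReal, ∀ᵐ t ∂(volume.restrict (Ioo 0 T)), AEStronglyMeasurable (f t) volume ∧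
      eLpNorm (f t) p (volume.restrict (Metric.closedBall 0 R)) ≤ C := by
  obtain ⟨C, hC⟩ := hf.bound
  obtain ⟨N, hN⟩ := exists_eLpNorm_closedBall_le R hp0 hp
  refine ⟨N * C, ?_⟩
  filter_upwards [hC, hf.ae_aestronglyMeasurable] with t ht htm
  refine ⟨htm, (hN (f t) (hf.periodic t)).trans ?_⟩
  push_cast
  gcongr

/-- Mollifying at a point of the box may use values outside it, so integrability is needed on larger
balls. The bound uniform in time is integrated over the finite interval. -/
lemma memLp_closedBall (hf : BoundedFamily T p f) (hp0 : p ≠ 0) (hp : p ≠ ⊤) (R : ℝ) :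
    MemLp (fun z : ℝ × Plane => f z.1 z.2) p
      (volume.restrict (Ioo 0 T ×ˢ Metric.closedBall 0 R)) := by
  have hm : AEStronglyMeasurable (fun z : ℝ × Plane => f z.1 z.2)
      (volume.restrict (Ioo 0 T ×ˢ Metric.closedBall 0 R)) :=
    hf.aestronglyMeasurable.mono_measure
      (Measure.restrict_mono (prod_mono subset_rfl (subset_univ _)) le_rfl)
  refine ⟨hm, ?_⟩
  obtain ⟨C, hC⟩ := hf.exists_bound_closedBall hp0 hp R
  have hpr : 0 < p.toReal := ENNReal.toReal_pos hp0 hp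
  rw [eLpNorm_lt_top_iff_lintegral_rpow_enorm_lt_top hp0 hp, restrict_prod_eq, lintegral_prod]
  · calc _ ≤ ∫⁻ t in Ioo 0 T, (C : ENNReal) ^ p.toReal := by
          refine lintegral_mono_ae ?_
          filter_upwards [hC] with t ht
          have := ht.2
          rw [eLpNorm_eq_lintegral_rpow_enorm_toReal hp0 hp] at this
          calc _ = ((∫⁻ x in Metric.closedBall 0 R, ‖f t x‖ₑ ^ p.toReal) ^ (1 / p.toReal)) ^
                p.toReal := by rw [← ENNReal.rpow_mul, one_div_mul_cancel hpr.ne', ENNReal.rpow_one]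
            _ ≤ _ := by gcongr
      _ < ⊤ := by
          rw [lintegral_const]
          exact ENNReal.mul_lt_top (ENNReal.rpow_lt_top_of_nonneg hpr.le (by simp)) (by simp)
  · rw [restrict_prod_eq] at hm
    exact hm.enorm.pow_const _

lemma memLp_slab (hf : BoundedFamily T p f) (hp0 : p ≠ 0) (hp : p ≠ ⊤) :
    MemLp (fun z : ℝ × Plane => f z.1 z.2) p (volume.restrict (slab T)) :=
  (hf.memLp_closedBall hp0 hp 10).mono_measure (Measure.restrict_mono
    (prod_mono subset_rfl fun x hx => by simpa using norm_le_of_mem_box hx) le_rfl)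

/-- Balls of integer radius suffice, so the exceptional sets of times form a countable union of null
sets. -/
lemma ae_locallyIntegrable (hf : BoundedFamily T 1 f) :
    ∀ᵐ t ∂(volume.restrict (Ioo 0 T)), LocallyIntegrable (f t) := by
  have h : ∀ n : ℕ, ∀ᵐ t ∂(volume.restrict (Ioo 0 T)),
      IntegrableOn (f t) (Metric.closedBall 0 n) := by
    intro n
    obtain ⟨C, hC⟩ := hf.exists_bound_closedBall (by simp) (by simp) n
    filter_upwards [hC] with t ht
    exact memLp_one_iff_integrable.1 ⟨ht.1.restrict, ht.2.trans_lt (by simp)⟩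
  filter_upwards [ae_all_iff.2 h] with t ht x
  obtain ⟨n, hn⟩ := exists_nat_ge (‖x‖ + 1)
  refine ⟨Metric.closedBall 0 n, ?_, ht n⟩
  filter_upwards [eventually_norm_le x] with y hy
  simpa using hy.trans hn

lemma of_two (hf : BoundedFamily T 2 f) : BoundedFamily T 1 f := by
  refine ⟨hf.periodic, hf.aestronglyMeasurable, ?_⟩
  obtain ⟨C, hC⟩ := hf.bound
  set D : ENNReal := volume.restrict (box) univ ^ (1 / (1 : ENNReal).toReal - 1 / (2 : ENNReal).toReal)
  have hD : D ≠ ⊤ := ENNReal.rpow_ne_top_of_nonneg (by norm_num) (measure_ne_top _ _)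
  lift D to NNReal using hD with D' hD'
  refine ⟨C * D', ?_⟩
  filter_upwards [hC, hf.ae_aestronglyMeasurable] with t ht htm
  refine (eLpNorm_le_eLpNorm_mul_rpow_measure_univ (p := 1) (q := 2) (by norm_num)
    htm.restrict).trans ?_
  rw [ENNReal.coe_mul, hD']
  gcongr

variable [NormedSpace ℝ E]

/-- The convolution of a bounded family with a kernel has a jointly measurable version. -/
lemma exists_stronglyMeasurable_conv (hf : BoundedFamily T p f) {K : Plane → ℝ} (hK : IsKernel K) :
    ∃ g : ℝ × Plane → E, StronglyMeasurable g ∧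
      ∀ᵐ t ∂(volume.restrict (Ioo 0 T)), ∀ x, conv K (f t) x = g (t, x) := by
  have hm := hf.aestronglyMeasurable
  rw [restrict_prod_eq, Measure.restrict_univ] at hm
  -- Convolve a strongly measurable version of `f`. At almost every time its slice agrees a.e. with
  -- `f t`, and convolution then gives equality at every `x`.
  refine ⟨fun z => ∫ y, K y • hm.mk _ (z.1, z.2 - y), ?_, ?_⟩
  · refine StronglyMeasurable.integral_prod_right (f := fun (z : ℝ × Plane) (y : Plane) =>
      K y • hm.mk _ (z.1, z.2 - y)) ?_
    refine (hK.contDiff.continuous.stronglyMeasurable.comp_measurable measurable_snd).smul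
      (hm.stronglyMeasurable_mk.comp_measurable ?_)
    fun_prop
  · filter_upwards [Measure.ae_ae_of_ae_prod hm.ae_eq_mk] with t ht x
    exact congrFun (convolution_congr (L := ContinuousLinearMap.lsmul ℝ ℝ) (f := K)
      (ae_eq_refl _) ht) x

lemma aestronglyMeasurable_conv (hf : BoundedFamily T p f) {K : Plane → ℝ} (hK : IsKernel K) :
    AEStronglyMeasurable (fun z : ℝ × Plane => conv K (f z.1) z.2) (volume.restrict (slab T)) := by
  obtain ⟨g, hg, h⟩ := hf.exists_stronglyMeasurable_conv hK
  refine hg.aestronglyMeasurable.congr ?_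
  filter_upwards [ae_slab_of_ae_time h] with z hz using (hz z.2).symm

lemma aestronglyMeasurable_conv_time (hf : BoundedFamily T p f) {K : Plane → ℝ} (hK : IsKernel K)
    (x : Plane) :
    AEStronglyMeasurable (fun t => conv K (f t) x) (volume.restrict (Ioo 0 T)) := by
  obtain ⟨g, hg, h⟩ := hf.exists_stronglyMeasurable_conv hK
  refine (hg.comp_measurable (measurable_prodMk_right (y := x))).aestronglyMeasurable.congr ?_
  filter_upwards [h] with t ht using (ht x).symm

/-- The convolution of a bounded family with a kernel is bounded. -/
lemma exists_bound_conv (hf : BoundedFamily T 1 f) {K : Plane → ℝ} (hK : IsKernel K) :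
    ∃ C : ℝ, ∀ᵐ t ∂(volume.restrict (Ioo 0 T)), ∀ x ∈ box, ‖conv K (f t) x‖ ≤ C := by
  obtain ⟨ρ, -, hρ⟩ := hK.compactSupport.exists_norm_bound
  obtain ⟨M, hM⟩ := hK.compactSupport.exists_bound_of_continuous hK.contDiff.continuous
  -- From a point of the box, a kernel of radius `ρ` sees only the ball of radius `10 + ρ`.
  obtain ⟨C, hC⟩ := hf.exists_bound_closedBall one_ne_zero ENNReal.one_ne_top (10 + ρ)
  have hM0 : 0 ≤ M := (norm_nonneg _).trans (hM 0)
  refine ⟨M * C, ?_⟩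
  filter_upwards [hC] with t ht x hx
  set B := Metric.closedBall (0 : Plane) (10 + ρ)
  have hi : IntegrableOn (f t) B :=
    memLp_one_iff_integrable.1 ⟨ht.1.restrict, ht.2.trans_lt (by simp)⟩
  have hn : ∫ y in B, ‖f t y‖ ≤ C := by
    rw [integral_norm_eq_lintegral_enorm hi.1, ← eLpNorm_one_eq_lintegral_enorm]
    exact ENNReal.toReal_le_coe_of_le_coe ht.2
  have heq : conv K (f t) x = ∫ y in B, K (x - y) • f t y := by
    rw [conv_apply', setIntegral_eq_integral_of_forall_compl_eq_zero]
    intro y hy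
    rw [hρ, zero_smul]
    have h1 : 10 + ρ < ‖y‖ := by simpa [B] using hy
    have h2 := norm_le_of_mem_box hx
    have h3 : ‖y‖ ≤ ‖x‖ + ‖x - y‖ := by
      simpa using norm_sub_le x (x - y)
    linarith
  rw [heq]
  calc _ ≤ ∫ y in B, M * ‖f t y‖ := by
        refine norm_integral_le_of_norm_le (hi.norm.const_mul M) (ae_of_all _ fun y => ?_)
        rw [norm_smul]
        exact mul_le_mul_of_nonneg_right (hM _) (norm_nonneg _)
    _ = M * ∫ y in B, ‖f t y‖ := integral_const_mul _ _
    _ ≤ M * C := mul_le_mul_of_nonneg_left hn hM0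

lemma memLp_conv (hf : BoundedFamily T 1 f) {K : Plane → ℝ} (hK : IsKernel K) (q : ENNReal) :
    MemLp (fun z : ℝ × Plane => conv K (f z.1) z.2) q (volume.restrict (slab T)) := by
  obtain ⟨C, hC⟩ := hf.exists_bound_conv hK
  refine MemLp.of_bound (hf.aestronglyMeasurable_conv hK) C ?_
  filter_upwards [ae_slab_of_ae_time hC, ae_mem_slab T] with z hz hz' using hz _ hz'.2

end BoundedFamily

/-! ### Mollifiers -/

/-- The rescaled mollifier `ε⁻² φ(x / ε)`. -/
noncomputable def rescale (φ : Plane → ℝ) (ε : ℝ) (y : Plane) : ℝ := (ε ^ 2)⁻¹ * φ (ε⁻¹ • y)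

lemma mollify_eq_conv {E : Type*} [NormedAddCommGroup E] [NormedSpace ℝ E] (φ : Plane → ℝ) (ε : ℝ)
    (f : Plane → E) : mollify φ ε f = conv (rescale φ ε) f := rfl

lemma IsMollifier.isKernel {φ : Plane → ℝ} (hφ : IsMollifier φ) {ε : ℝ} (hε : 0 < ε) :
    IsKernel (rescale φ ε) :=
  ⟨contDiff_const.mul (hφ.contDiff.comp (contDiff_const_smul _)),
    (hφ.compactSupport.comp_smul (inv_ne_zero hε.ne')).mul_left⟩

lemma IsMollifier.rescale_nonneg {φ : Plane → ℝ} (hφ : IsMollifier φ) (ε : ℝ) (y : Plane) :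
    0 ≤ rescale φ ε y := mul_nonneg (by positivity) (hφ.nonneg _)

lemma IsMollifier.integral_rescale {φ : Plane → ℝ} (hφ : IsMollifier φ) {ε : ℝ} (hε : 0 < ε) :
    ∫ y, rescale φ ε y = 1 := by
  simp only [rescale]
  rw [integral_const_mul, Measure.integral_comp_inv_smul, hφ.integral_eq_one]
  simp [abs_of_pos hε, hε.ne']

/-- Mollifications of a bounded family converge in `L^p`. -/
theorem BoundedFamily.tendsto_mollify {E : Type} [NormedAddCommGroup E] [NormedSpace ℝ E]
    [CompleteSpace E] {T : ℝ} {p : ENNReal} {f : ℝ → Plane → E} (hf : BoundedFamily T p f)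
    (hp1 : 1 ≤ p) (hp : p ≠ ⊤) {φ : Plane → ℝ} (hφ : IsMollifier φ) :
    Tendsto (fun ε => eLpNorm (fun z : ℝ × Plane => mollify φ ε (f z.1) z.2 - f z.1 z.2) p
      (volume.restrict (slab T))) (𝓝[>] 0) (𝓝 0) := by
  have hp0 : p ≠ 0 := (zero_lt_one.trans_le hp1).ne'
  obtain ⟨ρ, hρ0, hρ⟩ := hφ.compactSupport.exists_norm_bound
  -- Cutting off to `S` gives a function in `L^p` of the whole space, where translation is
  -- continuous. For `ε < 1` the mollification over the slab does not see the cut-off.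
  set S : Set (ℝ × Plane) := Ioo 0 T ×ˢ Metric.closedBall 0 (10 + ρ)
  have hS : MeasurableSet S := measurableSet_Ioo.prod measurableSet_closedBall
  set F : ℝ × Plane → E := S.indicator fun z => f z.1 z.2
  have hF : MemLp F p volume :=
    (memLp_indicator_iff_restrict hS).2 (hf.memLp_closedBall hp0 hp (10 + ρ))
  set g : ℝ × Plane → E := hF.1.mk F
  have hg : StronglyMeasurable g := hF.1.stronglyMeasurable_mk
  have hFg : F =ᵐ[volume] g := hF.1.ae_eq_mk
  have hgp : MemLp g p volume := hF.ae_eq hFg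
  have hslice : ∀ᵐ t : ℝ, (fun x => F (t, x)) =ᵐ[volume] fun x => g (t, x) := by
    rw [Measure.volume_eq_prod] at hFg
    exact Measure.ae_ae_of_ae_prod hFg
  rw [ENNReal.tendsto_nhds_zero]
  intro δ hδ
  have htr := ENNReal.tendsto_nhds_zero.1 (tendsto_eLpNorm_translate_sub hp1 hp hgp) δ hδ
  obtain ⟨r, hr, hball⟩ := Metric.eventually_nhds_iff.1 htr
  have hsmall : ∀ᶠ ε : ℝ in 𝓝[>] 0, ε * ρ < r := by
    have : Tendsto (fun ε : ℝ => ε * ρ) (𝓝[>] 0) (𝓝 (0 * ρ)) :=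
      (tendsto_id.mul_const ρ).mono_left nhdsWithin_le_nhds
    exact this.eventually (gt_mem_nhds (by simpa using hr))
  filter_upwards [hsmall, self_mem_nhdsWithin, nhdsWithin_le_nhds (gt_mem_nhds one_pos)]
    with ε hε hε0 hε1
  have hε0 : 0 < ε := hε0
  have hK := hφ.isKernel hε0
  have hKsupp : ∀ y, rescale φ ε y ≠ 0 → ‖y‖ ≤ ε * ρ := by
    intro y hy
    by_contra hcon
    refine hy ?_
    rw [rescale, hρ, mul_zero]
    rw [norm_smul, norm_inv, Real.norm_of_nonneg hε0.le, lt_inv_mul_iff₀ hε0]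
    exact not_le.1 hcon
  have key := eLpNorm_average_translate_sub_le hp1 hp hg hK.contDiff.continuous hK.compactSupport
    (hφ.rescale_nonneg ε) (hφ.integral_rescale hε0) (δ := δ) fun y hy => hball (by
      simpa [Prod.dist_eq] using (hKsupp y hy).trans_lt hε)
  refine le_trans (le_of_eq ?_) ((eLpNorm_restrict_le _ _ _ (slab T)).trans key)
  refine eLpNorm_congr_ae ?_
  filter_upwards [ae_restrict_of_ae hFg, ae_slab_of_ae_time (ae_restrict_of_ae hslice),
    ae_mem_slab T] with z hz1 hz2 hz
  have hFz : ∀ y, ‖y‖ ≤ 10 + ρ → F (z.1, y) = f z.1 y := fun y hy =>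
    indicator_of_mem (show (z.1, y) ∈ S from ⟨hz.1, by simpa using hy⟩) _
  have hzn := norm_le_of_mem_box hz.2
  rw [mollify_eq_conv]
  congr 1
  · have e1 : (∫ y, rescale φ ε y • g (z - (0, y))) = conv (rescale φ ε) (fun x => g (z.1, x)) z.2 := by
      rw [conv_apply]
      congr 1; ext y; congr 2; ext <;> simp
    rw [e1]
    have e2 := congrFun (convolution_congr (L := ContinuousLinearMap.lsmul ℝ ℝ) (f := rescale φ ε)
      (ae_eq_refl _) hz2) z.2
    refine Eq.trans ?_ e2
    change conv (rescale φ ε) (f z.1) z.2 = conv (rescale φ ε) (fun x => F (z.1, x)) z.2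
    simp only [conv_apply]
    congr 1; ext y
    by_cases hy : rescale φ ε y = 0
    · simp [hy]
    · have hyn : ‖y‖ ≤ ρ := (hKsupp y hy).trans (by nlinarith)
      rw [hFz]
      exact (norm_sub_le _ _).trans (by linarith)
  · rw [← hz1]
    exact (hFz z.2 (by linarith)).symm

/-! ### Derivatives of test functions -/

/-- The coordinate directions of the plane. -/
noncomputable abbrev dir (i : Fin 2) : Plane := EuclideanSpace.single i 1

lemma eq_sum_dir (v : Plane) : v = v 0 • dir 0 + v 1 • dir 1 := by
  ext i; fin_cases i <;> simp

lemma inner_gradient_eq_fderiv (f : Plane → ℝ) (x v : Plane) :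
    inner ℝ v (gradient f x) = fderiv ℝ f x v := by
  rw [real_inner_comm, gradient, InnerProductSpace.toDual_symm_apply]

lemma timeDeriv_eq {ψ : ℝ × Plane → ℝ} (hψ : ContDiff ℝ ∞ ψ) (z : ℝ × Plane) :
    timeDeriv ψ z = fderiv ℝ ψ z (1, 0) := by
  have h := ((hψ.differentiable (by simp)) z).hasFDerivAt
  have h1 : HasDerivAt (fun s : ℝ => ((s, z.2) : ℝ × Plane)) (1, 0) z.1 :=
    (hasDerivAt_id z.1).prodMk (hasDerivAt_const z.1 z.2)
  exact (h.comp_hasDerivAt z.1 h1).deriv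

lemma inner_spaceGrad_eq {ψ : ℝ × Plane → ℝ} (hψ : ContDiff ℝ ∞ ψ) (z : ℝ × Plane) (v : Plane) :
    inner ℝ v (spaceGrad ψ z) = fderiv ℝ ψ z (0, v) := by
  have h := ((hψ.differentiable (by simp)) z).hasFDerivAt
  have h1 : HasFDerivAt (fun y : Plane => ((z.1, y) : ℝ × Plane))
      (ContinuousLinearMap.inr ℝ ℝ Plane) z.2 := hasFDerivAt_prodMk_right z.1 z.2
  have h2 : HasFDerivAt (fun y => ψ (z.1, y)) _ z.2 := HasFDerivAt.comp z.2 h h1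
  rw [spaceGrad, inner_gradient_eq_fderiv, h2.fderiv]
  rfl

lemma transport_eq_fderiv {ψ : ℝ × Plane → ℝ} (hψ : ContDiff ℝ ∞ ψ) (z : ℝ × Plane) (v : Plane) :
    timeDeriv ψ z + inner ℝ v (spaceGrad ψ z) = fderiv ℝ ψ z (1, v) := by
  rw [timeDeriv_eq hψ, inner_spaceGrad_eq hψ, ← map_add]
  simp

lemma fderiv_eq_sum (ψ : ℝ × Plane → ℝ) (z : ℝ × Plane) (v : Plane) :
    fderiv ℝ ψ z (1, v) = fderiv ℝ ψ z (1, 0) +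
      (v 0 * fderiv ℝ ψ z (0, dir 0) + v 1 * fderiv ℝ ψ z (0, dir 1)) := by
  have : ((1, v) : ℝ × Plane) = (1, 0) + (v 0 • (0, dir 0) + v 1 • (0, dir 1)) := by
    ext1
    · simp
    · simpa using eq_sum_dir v
  rw [this, map_add, map_add, map_smul, map_smul, smul_eq_mul, smul_eq_mul]

lemma continuous_fderiv_apply {ψ : ℝ × Plane → ℝ} (hψ : ContDiff ℝ ∞ ψ) (v : ℝ × Plane) :
    Continuous fun z => fderiv ℝ ψ z v :=
  (hψ.continuous_fderiv (by simp)).clm_apply continuous_const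

/-- Continuous functions are bounded on the slab. -/
lemma _root_.Continuous.memLp_slab {T : ℝ} {b : ℝ × Plane → ℝ} (hb : Continuous b) (p : ENNReal) :
    MemLp b p (volume.restrict (slab T)) := by
  obtain ⟨C, hC⟩ := ((isCompact_Icc (a := (0 : ℝ)) (b := T)).prod
    isCompact_box).exists_bound_of_continuousOn hb.continuousOn
  refine MemLp.of_bound hb.aestronglyMeasurable.restrict C ?_
  filter_upwards [ae_mem_slab T] with z hz using hC z ⟨Ioo_subset_Icc_self hz.1, hz.2⟩

lemma integrable_mul_of_continuous {T : ℝ} {f b : ℝ × Plane → ℝ}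
    (hf : Integrable f (volume.restrict (slab T))) (hb : Continuous b) :
    Integrable (fun z => f z * b z) (volume.restrict (slab T)) :=
  memLp_one_iff_integrable.1 (MemLp.mul (p := 1) (q := ⊤) (hb.memLp_slab ⊤)
    (memLp_one_iff_integrable.2 hf))

/-! ### Convolutions as integrals over the period box -/

section

variable {K : Plane → ℝ} {f : Plane → ℝ}

/-- For fixed `x` the mollified value is a pairing over the box with a smooth periodic function,
that is, with an admissible test function. -/
lemma IsKernel.conv_eq_integral_box (hK : IsKernel K) (hf : IsPeriodic f)
    (hfi : LocallyIntegrable f) (x : Plane) :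
    conv K f x = ∫ y in box, f y * periodize (fun y => K (x - y)) y := by
  rw [integral_mul_periodize hf hfi (hK.reflect x).contDiff.continuous
    (hK.reflect x).compactSupport, conv_apply']
  simp [mul_comm]

lemma fderiv_reflect (hK : IsKernel K) (x y v : Plane) :
    fderiv ℝ (fun y => K (x - y)) y v = -fderiv ℝ K (x - y) v := by
  have h : HasFDerivAt (fun y => K (x - y)) _ y :=
    ((hK.contDiff.differentiable (by simp)) (x - y)).hasFDerivAt.comp y
      ((hasFDerivAt_id y).const_sub x)
  rw [h.fderiv]
  simp

/-- The minus sign comes from the reflection `y ↦ x - y`. -/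
lemma IsKernel.conv_partialDeriv_eq_integral_box (hK : IsKernel K) (hf : IsPeriodic f)
    (hfi : LocallyIntegrable f) (x v : Plane) :
    conv (fun y => fderiv ℝ K y v) f x =
      -∫ y in box, f y * fderiv ℝ (periodize fun y => K (x - y)) y v := by
  have hR := hK.reflect x
  simp_rw [fderiv_periodize hR.contDiff hR.compactSupport]
  rw [integral_mul_periodize hf hfi (hR.partialDeriv v).contDiff.continuous
    (hR.partialDeriv v).compactSupport, conv_apply', ← integral_neg]
  congr 1
  ext y
  rw [fderiv_reflect hK, smul_eq_mul]
  ring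

/-- The mollified velocity field is divergence free. -/
lemma IsVelocityOf.div_conv_eq_zero (hK : IsKernel K) {v : Plane → Plane} (h : IsVelocityOf f v)
    (hv : IsPeriodic v) (hvi : ∀ i, LocallyIntegrable fun y => v y i) (x : Plane) :
    conv (fun y => fderiv ℝ K y (dir 0)) (fun y => v y 0) x +
      conv (fun y => fderiv ℝ K y (dir 1)) (fun y => v y 1) x = 0 := by
  have hR := hK.reflect x
  have hc := contDiff_periodize hR.contDiff hR.compactSupport
  have hper : ∀ i, IsPeriodic fun y => v y i := fun i j y => by simp only [hv j y]
  rw [hK.conv_partialDeriv_eq_integral_box (hper 0) (hvi 0),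
    hK.conv_partialDeriv_eq_integral_box (hper 1) (hvi 1), ← neg_add, ← integral_add,
    h.integral_inner_gradient (hc.of_le (by simp)) (isPeriodic_periodize _), neg_zero]
  all_goals
    exact ((hvi _).integrableOn_isCompact isCompact_box).mul_continuousOn
      ((hc.continuous_fderiv (by simp)).clm_apply continuous_const).continuousOn isCompact_box

end

/-! ### The mollified equation -/

namespace IsWeakSolution

variable {T : ℝ} {θ₀ : Plane → ℝ} {θ : ℝ → Plane → ℝ} {u : ℝ → Plane → Plane}

lemma boundedFamily_scalar (h : IsWeakSolution T θ₀ θ u) : BoundedFamily T 2 θ :=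
  ⟨h.memLinftyL2.periodic, h.memLinftyL2.aestronglyMeasurable, h.memLinftyL2.bound⟩

lemma boundedFamily_velocity (h : IsWeakSolution T θ₀ θ u) : BoundedFamily T 2 u := by
  have hm : ∀ᵐ t ∂(volume.restrict (Ioo 0 T)), AEStronglyMeasurable (u t) volume := by
    have := h.velocity_aestronglyMeasurable
    rw [restrict_prod_eq, Measure.restrict_univ] at this
    exact this.prodMk_left
  refine ⟨h.velocity_periodic, h.velocity_aestronglyMeasurable, ?_⟩
  obtain ⟨C, hC⟩ := h.memLinftyL2.bound
  refine ⟨2 * C, ?_⟩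
  filter_upwards [hC, hm, h.boundedFamily_scalar.ae_aestronglyMeasurable, h.velocity]
    with t ht htu htθ htv
  refine (htv.eLpNorm_le ⟨htθ.restrict, ht.trans_lt (by simp)⟩ htu.restrict).trans ?_
  push_cast
  gcongr

lemma boundedFamily_coord (h : IsWeakSolution T θ₀ θ u) (i : Fin 2) :
    BoundedFamily T 2 (fun t x => u t x i) := by
  refine ⟨fun t j x => by simp only [h.velocity_periodic t j x],
    (EuclideanSpace.proj (𝕜 := ℝ) i).continuous.comp_aestronglyMeasurable
      h.velocity_aestronglyMeasurable, ?_⟩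
  obtain ⟨C, hC⟩ := h.boundedFamily_velocity.bound
  refine ⟨C, ?_⟩
  filter_upwards [hC] with t ht
  exact (eLpNorm_mono fun x => PiLp.norm_apply_le (u t x) i).trans ht

/-- By Hölder, a product of two `L²` families is bounded in `L¹`; this is why the limits of products
below are taken in `L¹`. -/
lemma boundedFamily_flux (h : IsWeakSolution T θ₀ θ u) (i : Fin 2) :
    BoundedFamily T 1 (fun t x => θ t x * u t x i) := by
  refine ⟨fun t j x => by simp only [h.velocity_periodic t j x, h.memLinftyL2.periodic t j x],
    h.boundedFamily_scalar.aestronglyMeasurable.mul (h.boundedFamily_coord i).aestronglyMeasurable,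
    ?_⟩
  obtain ⟨C, hC⟩ := h.boundedFamily_scalar.bound
  obtain ⟨D, hD⟩ := (h.boundedFamily_coord i).bound
  refine ⟨C * D, ?_⟩
  filter_upwards [hC, hD, h.boundedFamily_scalar.ae_aestronglyMeasurable,
    (h.boundedFamily_coord i).ae_aestronglyMeasurable] with t htC htD htm htm'
  refine (eLpNorm_smul_le_mul_eLpNorm (p := 2) (q := 2) (r := 1) htm'.restrict
    htm.restrict).trans ?_
  push_cast
  gcongr

lemma ae_velocity_div_conv (h : IsWeakSolution T θ₀ θ u) {K : Plane → ℝ} (hK : IsKernel K) :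
    ∀ᵐ t ∂(volume.restrict (Ioo 0 T)), ∀ x,
      conv (fun y => fderiv ℝ K y (dir 0)) (fun y => u t y 0) x +
        conv (fun y => fderiv ℝ K y (dir 1)) (fun y => u t y 1) x = 0 := by
  filter_upwards [h.velocity, (h.boundedFamily_coord 0).of_two.ae_locallyIntegrable,
    (h.boundedFamily_coord 1).of_two.ae_locallyIntegrable] with t hv h0 h1 x
  exact hv.div_conv_eq_zero hK (h.velocity_periodic t)
    (fun i => by fin_cases i; exacts [h0, h1]) x

/-- The divergence of the mollified flux. -/
noncomputable def fluxDiv (K : Plane → ℝ) (θ : ℝ → Plane → ℝ) (u : ℝ → Plane → Plane)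
    (z : ℝ × Plane) : ℝ :=
  conv (fun y => fderiv ℝ K y (dir 0)) (fun y => θ z.1 y * u z.1 y 0) z.2 +
    conv (fun y => fderiv ℝ K y (dir 1)) (fun y => θ z.1 y * u z.1 y 1) z.2

lemma memLp_fluxDiv (h : IsWeakSolution T θ₀ θ u) {K : Plane → ℝ} (hK : IsKernel K) :
    MemLp (fluxDiv K θ u) ⊤ (volume.restrict (slab T)) :=
  ((h.boundedFamily_flux 0).memLp_conv (hK.partialDeriv _) ⊤).add
    ((h.boundedFamily_flux 1).memLp_conv (hK.partialDeriv _) ⊤)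

lemma _root_.QG.BoundedFamily.integrableOn_conv_time {f : ℝ → Plane → ℝ}
    (hf : BoundedFamily T 1 f) {K : Plane → ℝ} (hK : IsKernel K) {x : Plane} (hx : x ∈ box) :
    IntegrableOn (fun t => conv K (f t) x) (Ioo 0 T) := by
  obtain ⟨C, hC⟩ := hf.exists_bound_conv hK
  refine memLp_one_iff_integrable.1 (MemLp.of_bound (hf.aestronglyMeasurable_conv_time hK x) C ?_)
  filter_upwards [hC] with t ht using ht x hx

lemma _root_.QG.BoundedFamily.integrable_slab {f : ℝ → Plane → ℝ} (hf : BoundedFamily T 1 f) :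
    Integrable (fun z : ℝ × Plane => f z.1 z.2) (volume.restrict (slab T)) :=
  memLp_one_iff_integrable.1 (hf.memLp_slab one_ne_zero ENNReal.one_ne_top)

lemma integral_slab {g : ℝ × Plane → ℝ} (hg : Integrable g (volume.restrict (slab T))) :
    ∫ z in slab T, g z = ∫ t in Ioo 0 T, ∫ x in box, g (t, x) := by
  rw [restrict_slab] at hg ⊢
  exact integral_prod _ hg

lemma integral_slab_mul_mul {f : ℝ → Plane → ℝ} (hf : BoundedFamily T 1 f) {a : ℝ → ℝ}
    {b : Plane → ℝ} (ha : Continuous a) (hb : Continuous b) :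
    Integrable (fun z : ℝ × Plane => a z.1 * (f z.1 z.2 * b z.2)) (volume.restrict (slab T)) ∧
    ∫ z in slab T, a z.1 * (f z.1 z.2 * b z.2) = ∫ t in Ioo 0 T, a t * ∫ x in box, f t x * b x := by
  have hi : Integrable (fun z : ℝ × Plane => a z.1 * (f z.1 z.2 * b z.2))
      (volume.restrict (slab T)) := by
    have := integrable_mul_of_continuous hf.integrable_slab
      (b := fun z => a z.1 * b z.2) (by fun_prop)
    refine this.congr (ae_of_all _ fun z => ?_)
    simp only
    ring
  refine ⟨hi, ?_⟩
  rw [integral_slab hi]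
  simp only [integral_const_mul]

/-- The equation for the mollified scalar at a fixed point, in the weak sense in time. -/
lemma integral_conv_mul_deriv (h : IsWeakSolution T θ₀ θ u) {K : Plane → ℝ}
    (hK : IsKernel K) {x : Plane} {χ : ℝ → ℝ} (hχ : IsTimeTest T χ) :
    ∫ t in Ioo 0 T, conv K (θ t) x * deriv χ t =
      -∫ t in Ioo 0 T, -fluxDiv K θ u (t, x) * χ t := by
  have hR := hK.reflect x
  set κ := periodize fun y => K (x - y)
  have hκ : ContDiff ℝ ∞ κ := contDiff_periodize hR.contDiff hR.compactSupport
  have hκd : ∀ i, Continuous fun y => fderiv ℝ κ y (dir i) := fun i =>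
    (hκ.continuous_fderiv (by simp)).clm_apply continuous_const
  have hχd : Continuous (deriv χ) := hχ.1.continuous_deriv (by simp)
  have hψ : ContDiff ℝ ∞ fun z : ℝ × Plane => χ z.1 * κ z.2 :=
    (hχ.1.comp contDiff_fst).mul (hκ.comp contDiff_snd)
  obtain ⟨-, a, b, ha, hab, hb, hsupp⟩ := id hχ
  -- Test with `χ(t)` times the periodization of `y ↦ K(x - y)`; `χ` vanishes at time 0, so the
  -- initial term drops out.
  have w := h.weak ⟨fun z => χ z.1 * κ z.2, hψ,
    fun t i y => by simp only [isPeriodic_periodize _ i y, κ], Icc a b, isCompact_Icc,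
    fun t ht => ht.2.trans_lt hb, fun t ht y => by simp [hsupp t ht]⟩
  simp only [hχ.boundary_eq_zero.1, zero_mul, mul_zero, integral_zero, add_zero] at w
  have hd : ∀ z : ℝ × Plane, θ z.1 z.2 * (timeDeriv (fun z : ℝ × Plane => χ z.1 * κ z.2) z +
      inner ℝ (u z.1 z.2) (spaceGrad (fun z : ℝ × Plane => χ z.1 * κ z.2) z)) =
      deriv χ z.1 * (θ z.1 z.2 * κ z.2) +
      (χ z.1 * ((θ z.1 z.2 * u z.1 z.2 0) * fderiv ℝ κ z.2 (dir 0)) +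
        χ z.1 * ((θ z.1 z.2 * u z.1 z.2 1) * fderiv ℝ κ z.2 (dir 1))) := by
    intro z
    have h1 : HasFDerivAt (fun z : ℝ × Plane => χ z.1) _ z :=
      ((hχ.1.differentiable (by simp)) z.1).hasDerivAt.hasFDerivAt.comp z hasFDerivAt_fst
    have h2 : HasFDerivAt (fun z : ℝ × Plane => κ z.2) _ z :=
      ((hκ.differentiable (by simp)) z.2).hasFDerivAt.comp z hasFDerivAt_snd
    rw [transport_eq_fderiv hψ, fderiv_eq_sum, (h1.fun_mul h2).fderiv]
    simp
    ring
  simp only [hd] at w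
  obtain ⟨i0, e0⟩ := integral_slab_mul_mul h.boundedFamily_scalar.of_two hχd hκ.continuous
  obtain ⟨i1, e1⟩ := integral_slab_mul_mul (h.boundedFamily_flux 0) hχ.1.continuous (hκd 0)
  obtain ⟨i2, e2⟩ := integral_slab_mul_mul (h.boundedFamily_flux 1) hχ.1.continuous (hκd 1)
  rw [integral_add i0 (i1.fun_add i2), integral_add i1 i2, e0, e1, e2] at w
  have hint : ∀ {f : ℝ → Plane → ℝ}, BoundedFamily T 1 f → ∀ {a : ℝ → ℝ} {b : Plane → ℝ},
      Continuous a → Continuous b →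
      Integrable (fun t => a t * ∫ y in box, f t y * b y) (volume.restrict (Ioo 0 T)) := by
    intro f hf a b ha hb
    have := (integral_slab_mul_mul hf ha hb).1
    rw [restrict_slab] at this
    simpa only [integral_const_mul] using this.integral_prod_left
  have f0 : ∫ t in Ioo 0 T, conv K (θ t) x * deriv χ t =
      ∫ t in Ioo 0 T, deriv χ t * ∫ y in box, θ t y * κ y := by
    refine integral_congr_ae ?_
    filter_upwards [h.boundedFamily_scalar.of_two.ae_locallyIntegrable] with t ht
    rw [hK.conv_eq_integral_box (h.memLinftyL2.periodic t) ht, mul_comm]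
  have f1 : ∫ t in Ioo 0 T, -fluxDiv K θ u (t, x) * χ t =
      ∫ t in Ioo 0 T, ((χ t * ∫ y in box, θ t y * u t y 0 * fderiv ℝ κ y (dir 0)) +
        χ t * ∫ y in box, θ t y * u t y 1 * fderiv ℝ κ y (dir 1)) := by
    refine integral_congr_ae ?_
    filter_upwards [(h.boundedFamily_flux 0).ae_locallyIntegrable,
      (h.boundedFamily_flux 1).ae_locallyIntegrable] with t h0 h1
    rw [fluxDiv, hK.conv_partialDeriv_eq_integral_box ((h.boundedFamily_flux 0).periodic t) h0,
      hK.conv_partialDeriv_eq_integral_box ((h.boundedFamily_flux 1).periodic t) h1]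
    ring
  rw [f0, f1, integral_add (hint (h.boundedFamily_flux 0) hχ.1.continuous (hκd 0))
    (hint (h.boundedFamily_flux 1) hχ.1.continuous (hκd 1))]
  linarith

end IsWeakSolution

/-! ### Bounded functions on the slab -/

section

variable {X : Type*} [MeasurableSpace X] {μ : Measure X} {f g : X → ℝ}

lemma _root_.MeasureTheory.MemLp.mul_top (hf : MemLp f ⊤ μ) (hg : MemLp g ⊤ μ) :
    MemLp (fun x => f x * g x) ⊤ μ := MemLp.mul (p := ⊤) (q := ⊤) hg hf

/-- The values lie a.e. in a compact interval, so no growth condition on `G` is needed. This covers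
`G''(θ_ε)` at fixed `ε`, although `G''` itself may be unbounded. -/
lemma _root_.MeasureTheory.MemLp.comp_continuous_top [IsFiniteMeasure μ] (hf : MemLp f ⊤ μ)
    {G : ℝ → ℝ} (hG : Continuous G) : MemLp (fun x => G (f x)) ⊤ μ := by
  have hae := ae_le_eLpNormEssSup (f := f) (μ := μ)
  have hlt : eLpNormEssSup f μ < ⊤ := by simpa using hf.2
  set C := (eLpNormEssSup f μ).toReal
  obtain ⟨D, hD⟩ := (isCompact_Icc (a := -C) (b := C)).exists_bound_of_continuousOn hG.continuousOn
  refine MemLp.of_bound (hG.comp_aestronglyMeasurable hf.1) D ?_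
  filter_upwards [hae] with x hx
  refine hD _ (abs_le.1 ?_)
  have := ENNReal.toReal_mono hlt.ne hx
  simpa using this

lemma _root_.MeasureTheory.MemLp.integrable_top [IsFiniteMeasure μ] (hf : MemLp f ⊤ μ) :
    Integrable f μ := memLp_one_iff_integrable.1 (hf.mono_exponent le_top)

end

/-! ### The local balance at a fixed time -/

/-- The balance obtained by integrating the divergence of the field
`η (G'(Θ) (Θ U - W) - G(Θ) U)`, for a divergence free field `U`. -/
lemma integral_box_balance {Θ η : Plane → ℝ} {U W : Fin 2 → Plane → ℝ} {G : ℝ → ℝ}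
    (hG : ContDiff ℝ 2 G) (hΘ : ContDiff ℝ 1 Θ) (hη : ContDiff ℝ 1 η)
    (hU : ∀ i, ContDiff ℝ 1 (U i)) (hW : ∀ i, ContDiff ℝ 1 (W i))
    (hΘp : IsPeriodic Θ) (hηp : IsPeriodic η) (hUp : ∀ i, IsPeriodic (U i))
    (hWp : ∀ i, IsPeriodic (W i))
    (hdiv : ∀ x, fderiv ℝ (U 0) x (dir 0) + fderiv ℝ (U 1) x (dir 1) = 0) :
    ∫ x in box, deriv (deriv G) (Θ x) * (fderiv ℝ Θ x (dir 0) * (Θ x * U 0 x - W 0 x) +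
        fderiv ℝ Θ x (dir 1) * (Θ x * U 1 x - W 1 x)) * η x =
    ∫ x in box, (G (Θ x) * (U 0 x * fderiv ℝ η x (dir 0) + U 1 x * fderiv ℝ η x (dir 1)) -
      deriv G (Θ x) * ((Θ x * U 0 x - W 0 x) * fderiv ℝ η x (dir 0) +
        (Θ x * U 1 x - W 1 x) * fderiv ℝ η x (dir 1)) +
      deriv G (Θ x) * (fderiv ℝ (W 0) x (dir 0) + fderiv ℝ (W 1) x (dir 1)) * η x) := by
  have hG1 : ContDiff ℝ 1 (deriv G) := ((contDiff_succ_iff_deriv (n := 1)).1 hG).2.2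
  have hG0 : ContDiff ℝ 1 G := hG.of_le (by norm_num)
  set V : Fin 2 → Plane → ℝ := fun i x =>
    η x * (deriv G (Θ x) * (Θ x * U i x - W i x) - G (Θ x) * U i x)
  have hV : ∀ i, ContDiff ℝ 1 (V i) := fun i =>
    hη.mul (((hG1.comp hΘ).mul ((hΘ.mul (hU i)).sub (hW i))).sub ((hG0.comp hΘ).mul (hU i)))
  have hVp : ∀ i, IsPeriodic (V i) := fun i j x => by
    simp only [V, hηp j x, hΘp j x, hUp i j x, hWp i j x]
  have hVd : ∀ i x, fderiv ℝ (V i) x (dir i) =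
      η x * (deriv G (Θ x) * (Θ x * fderiv ℝ (U i) x (dir i) + U i x * fderiv ℝ Θ x (dir i) -
          fderiv ℝ (W i) x (dir i)) +
        (Θ x * U i x - W i x) * (deriv (deriv G) (Θ x) * fderiv ℝ Θ x (dir i)) -
        (G (Θ x) * fderiv ℝ (U i) x (dir i) + U i x * (deriv G (Θ x) * fderiv ℝ Θ x (dir i)))) +
      (deriv G (Θ x) * (Θ x * U i x - W i x) - G (Θ x) * U i x) * fderiv ℝ η x (dir i) := by
    intro i x
    have dη := ((hη.differentiable (by simp)) x).hasFDerivAt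
    have dΘ := ((hΘ.differentiable (by simp)) x).hasFDerivAt
    have dU := ((hU i).differentiable (by simp) x).hasFDerivAt
    have dW := ((hW i).differentiable (by simp) x).hasFDerivAt
    have dG : HasFDerivAt (fun x => G (Θ x)) (deriv G (Θ x) • fderiv ℝ Θ x) x :=
      ((hG0.differentiable (by simp)) (Θ x)).hasDerivAt.comp_hasFDerivAt x dΘ
    have dG1 : HasFDerivAt (fun x => deriv G (Θ x)) (deriv (deriv G) (Θ x) • fderiv ℝ Θ x) x :=
      ((hG1.differentiable (by simp)) (Θ x)).hasDerivAt.comp_hasFDerivAt x dΘ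
    rw [(dη.fun_mul ((dG1.fun_mul ((dΘ.fun_mul dU).fun_sub dW)).fun_sub
      (dG.fun_mul dU))).fderiv]
    simp
  have hcV : ∀ i, Continuous fun x => fderiv ℝ (V i) x (dir i) := fun i =>
    ((hV i).continuous_fderiv (by simp)).clm_apply continuous_const
  have hci : ∀ {f : Plane → ℝ}, Continuous f → Integrable f (volume.restrict box) := fun hf =>
    memLp_one_iff_integrable.1 (hf.memLp_box 1)
  have h0 : ∫ x in box, (fderiv ℝ (V 0) x (dir 0) + fderiv ℝ (V 1) x (dir 1)) = 0 := by
    rw [integral_add (hci (hcV 0)) (hci (hcV 1)), integral_box_partialDeriv_eq_zero (hV 0) (hVp 0),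
      integral_box_partialDeriv_eq_zero (hV 1) (hVp 1), add_zero]
  have cd : ∀ {f : Plane → ℝ}, ContDiff ℝ 1 f → ∀ v, Continuous fun x => fderiv ℝ f x v :=
    fun hf v => (hf.continuous_fderiv (by simp)).clm_apply continuous_const
  have cG2 : Continuous (deriv (deriv G)) := hG1.continuous_deriv (by simp)
  have c1 := hΘ.continuous
  have c2 := hη.continuous
  have c3 := fun i => (hU i).continuous
  have c4 := fun i => (hW i).continuous
  have c5 := cd hΘ
  have c6 := cd hη
  have c7 := fun i => cd (hW i)
  have c8 := hG0.continuous
  have c9 := hG1.continuous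
  rw [← sub_eq_zero, ← integral_sub (hci (by fun_prop)) (hci (by fun_prop)), ← h0]
  congr 1
  ext x
  rw [hVd, hVd]
  have := hdiv x
  -- After expansion, the two sides differ only by multiples of `div U`.
  linear_combination (-(η x * deriv G (Θ x) * Θ x) + η x * G (Θ x)) * this

/-! ### The balance on the slab -/

lemma gradient_apply (f : Plane → ℝ) (x : Plane) (i : Fin 2) :
    gradient f x i = fderiv ℝ f x (dir i) := by
  rw [← inner_gradient_eq_fderiv, EuclideanSpace.inner_single_left]
  simp

namespace IsWeakSolution

variable {T : ℝ} {θ₀ : Plane → ℝ} {θ : ℝ → Plane → ℝ} {u : ℝ → Plane → Plane}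

/-- The defect in coordinates. -/
lemma defect_ae_eq (h : IsWeakSolution T θ₀ θ u) (G : ℝ → ℝ) {φ : Plane → ℝ} {ε : ℝ}
    (hK : IsKernel (rescale φ ε)) :
    ∀ᵐ t ∂(volume.restrict (Ioo 0 T)), ∀ x, defect φ G θ u ε (t, x) =
      deriv (deriv G) (conv (rescale φ ε) (θ t) x) *
        (fderiv ℝ (conv (rescale φ ε) (θ t)) x (dir 0) *
          (conv (rescale φ ε) (θ t) x * conv (rescale φ ε) (fun y => u t y 0) x -
            conv (rescale φ ε) (fun y => θ t y * u t y 0) x) +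
        fderiv ℝ (conv (rescale φ ε) (θ t)) x (dir 1) *
          (conv (rescale φ ε) (θ t) x * conv (rescale φ ε) (fun y => u t y 1) x -
            conv (rescale φ ε) (fun y => θ t y * u t y 1) x)) := by
  have hfl : BoundedFamily T 1 (fun t x => θ t x • u t x) := by
    refine ⟨fun t j x => by simp only [h.velocity_periodic t j x, h.memLinftyL2.periodic t j x],
      h.boundedFamily_scalar.aestronglyMeasurable.smul h.velocity_aestronglyMeasurable, ?_⟩
    obtain ⟨C, hC⟩ := h.boundedFamily_scalar.bound
    obtain ⟨D, hD⟩ := h.boundedFamily_velocity.bound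
    refine ⟨C * D, ?_⟩
    filter_upwards [hC, hD, h.boundedFamily_scalar.ae_aestronglyMeasurable,
      h.boundedFamily_velocity.ae_aestronglyMeasurable] with t htC htD htm htm'
    refine (eLpNorm_smul_le_mul_eLpNorm (p := 2) (q := 2) (r := 1) htm'.restrict
      htm.restrict).trans ?_
    push_cast
    gcongr
  filter_upwards [h.boundedFamily_velocity.of_two.ae_locallyIntegrable, hfl.ae_locallyIntegrable]
    with t hu hθu x
  simp only [defect, mollify_eq_conv]
  rw [PiLp.inner_apply, Fin.sum_univ_two]
  simp only [gradient_apply, PiLp.sub_apply, PiLp.smul_apply, smul_eq_mul, hK.conv_coord hu,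
    hK.conv_coord hθu, RCLike.inner_apply, conj_trivial]
  ring

variable {G : ℝ → ℝ} {K : Plane → ℝ}

/-- Chain rule in time for the mollified scalar. -/
lemma integral_slab_comp_mul_timeDeriv (h : IsWeakSolution T θ₀ θ u) (hT : 0 < T)
    (hG : ContDiff ℝ 1 G) {C : NNReal} (hGL : LipschitzWith C G) (hK : IsKernel K)
    (ψ : testFunctions (Ioo 0 T)) :
    ∫ z in slab T, G (conv K (θ z.1) z.2) * fderiv ℝ ψ.1 z (1, 0) =
      ∫ z in slab T, deriv G (conv K (θ z.1) z.2) * fluxDiv K θ u z * ψ.1 z := by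
  obtain ⟨ψ, hψ, hψp, L, hL, hLT, hψL⟩ := ψ
  simp only
  have mΘ := h.boundedFamily_scalar.of_two.memLp_conv hK ⊤
  have i1 : Integrable (fun z : ℝ × Plane => G (conv K (θ z.1) z.2) * fderiv ℝ ψ z (1, 0))
      (volume.restrict (slab T)) :=
    ((mΘ.comp_continuous_top hG.continuous).mul_top
      ((continuous_fderiv_apply hψ _).memLp_slab ⊤)).integrable_top
  have i2 : Integrable (fun z : ℝ × Plane =>
      deriv G (conv K (θ z.1) z.2) * fluxDiv K θ u z * ψ z) (volume.restrict (slab T)) :=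
    (((mΘ.comp_continuous_top (hG.continuous_deriv le_rfl)).mul_top (h.memLp_fluxDiv hK)).mul_top
      (hψ.continuous.memLp_slab ⊤)).integrable_top
  rw [restrict_slab] at i1 i2 ⊢
  -- Integrate in time first: at fixed `x` the test function is a time test function and the
  -- one-dimensional chain rule applies.
  rw [integral_prod_symm _ i1, integral_prod_symm _ i2]
  refine setIntegral_congr_fun measurableSet_box fun x hx => ?_
  have hχ : IsTimeTest T fun t => ψ (t, x) := by
    obtain ⟨a, b, ha, hab, hb, hLab⟩ := exists_Icc_of_isCompact hT hL hLT
    exact ⟨hψ.comp (contDiff_id.prodMk contDiff_const), a, b, ha, hab, hb,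
      fun t ht => hψL t (fun h => ht (hLab h)) x⟩
  have hd : ∀ t, deriv (fun t => ψ (t, x)) t = fderiv ℝ ψ (t, x) (1, 0) := fun t =>
    timeDeriv_eq hψ (t, x)
  have hi2 : IntegrableOn (fun t => -fluxDiv K θ u (t, x)) (Ioo 0 T) :=
    (((h.boundedFamily_flux 0).integrableOn_conv_time (hK.partialDeriv _) hx).add
      ((h.boundedFamily_flux 1).integrableOn_conv_time (hK.partialDeriv _) hx)).neg
  have key := integral_comp_mul_deriv_of_weakDeriv hT
    (h.boundedFamily_scalar.of_two.integrableOn_conv_time hK hx) hi2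
    (fun χ hχ => h.integral_conv_mul_deriv hK hχ) (hG.differentiable (by simp)) hGL hχ
  simp only [hd] at key
  simp only
  rw [key, ← integral_neg]
  congr 1
  ext t
  ring

/-- The balance for the mollified scalar. -/
theorem integral_slab_defect (h : IsWeakSolution T θ₀ θ u) (hT : 0 < T)
    (hG : ContDiff ℝ 2 G) {C : NNReal} (hGL : LipschitzWith C G) {φ : Plane → ℝ} {ε : ℝ}
    (hK : IsKernel (rescale φ ε)) (ψ : testFunctions (Ioo 0 T)) :
    IntegrableOn (defect φ G θ u ε) (slab T) ∧
    ∫ z in slab T, defect φ G θ u ε z * ψ.1 z =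
      ∫ z in slab T, (G (conv (rescale φ ε) (θ z.1) z.2) * fderiv ℝ ψ.1 z (1, 0) +
        (∑ i, (G (conv (rescale φ ε) (θ z.1) z.2) *
            conv (rescale φ ε) (fun y => u z.1 y i) z.2) * fderiv ℝ ψ.1 z (0, dir i) -
        ∑ i, (deriv G (conv (rescale φ ε) (θ z.1) z.2) *
          (conv (rescale φ ε) (θ z.1) z.2 * conv (rescale φ ε) (fun y => u z.1 y i) z.2 -
            conv (rescale φ ε) (fun y => θ z.1 y * u z.1 y i) z.2)) *
              fderiv ℝ ψ.1 z (0, dir i))) := by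
  have hG1 : ContDiff ℝ 1 (deriv G) := ((contDiff_succ_iff_deriv (n := 1)).1 hG).2.2
  have htime := h.integral_slab_comp_mul_timeDeriv hT (hG.of_le (by norm_num)) hGL hK ψ
  obtain ⟨ψ, hψ, hψp, L, hL, hLT, hψL⟩ := ψ
  simp only at htime ⊢
  have hD := h.defect_ae_eq G hK
  set K := rescale φ ε
  have hθ := h.boundedFamily_scalar.of_two
  have hv := fun i => (h.boundedFamily_coord i).of_two
  have hw := h.boundedFamily_flux
  have mΘ := hθ.memLp_conv hK ⊤
  have mU := fun i => (hv i).memLp_conv hK ⊤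
  have mW := fun i => (hw i).memLp_conv hK ⊤
  have mΘd := fun v => hθ.memLp_conv (hK.partialDeriv v) ⊤
  have mψ : ∀ v, MemLp (fun z => fderiv ℝ ψ z v) ⊤ (volume.restrict (slab T)) := fun v =>
    (continuous_fderiv_apply hψ v).memLp_slab ⊤
  have mG := mΘ.comp_continuous_top hG.continuous
  have mG1 := mΘ.comp_continuous_top hG1.continuous
  have mG2 := mΘ.comp_continuous_top (hG1.continuous_deriv le_rfl)
  have mR := fun i => (mΘ.mul_top (mU i)).sub (mW i)
  -- At fixed `ε` every factor is essentially bounded on the slab.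
  have mD : MemLp (defect φ G θ u ε) ⊤ (volume.restrict (slab T)) := by
    have := mG2.mul_top (((mΘd (dir 0)).mul_top (mR 0)).add ((mΘd (dir 1)).mul_top (mR 1)))
    refine this.ae_eq ?_
    filter_upwards [ae_slab_of_ae_time hD, ae_slab_of_ae_time hθ.ae_locallyIntegrable]
      with z hz hzi
    rw [show z = (z.1, z.2) from rfl, hz z.2, hK.fderiv_conv hzi, hK.fderiv_conv hzi]
    rfl
  refine ⟨mD.integrable_top, ?_⟩
  set A : ℝ × Plane → ℝ := fun z =>
    ∑ i, (G (conv K (θ z.1) z.2) * conv K (fun y => u z.1 y i) z.2) * fderiv ℝ ψ z (0, dir i) -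
      ∑ i, (deriv G (conv K (θ z.1) z.2) *
        (conv K (θ z.1) z.2 * conv K (fun y => u z.1 y i) z.2 -
          conv K (fun y => θ z.1 y * u z.1 y i) z.2)) * fderiv ℝ ψ z (0, dir i)
  have iA : Integrable A (volume.restrict (slab T)) := by
    refine MemLp.integrable_top (MemLp.sub ?_ ?_)
    · exact memLp_finsetSum _ fun i _ => (mG.mul_top (mU i)).mul_top (mψ _)
    · exact memLp_finsetSum _ fun i _ => (mG1.mul_top (mR i)).mul_top (mψ _)
  have iB : Integrable (fun z => deriv G (conv K (θ z.1) z.2) * fluxDiv K θ u z * ψ z)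
      (volume.restrict (slab T)) :=
    ((mG1.mul_top (h.memLp_fluxDiv hK)).mul_top (hψ.continuous.memLp_slab ⊤)).integrable_top
  have iG : Integrable (fun z : ℝ × Plane => G (conv K (θ z.1) z.2) * fderiv ℝ ψ z (1, 0))
      (volume.restrict (slab T)) := (mG.mul_top (mψ _)).integrable_top
  -- The time derivative is traded for `G'(θ_ε) div (uθ)_ε ψ`, which is the last term of the spatial
  -- balance; what remains is an identity at almost every time.
  rw [integral_add iG iA, htime, ← integral_add iB iA, integral_slab (iB.fun_add iA),
    integral_slab (mD.mul_top (hψ.continuous.memLp_slab ⊤)).integrable_top]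
  refine integral_congr_ae ?_
  filter_upwards [hD, hθ.ae_locallyIntegrable, (hv 0).ae_locallyIntegrable,
    (hv 1).ae_locallyIntegrable, (hw 0).ae_locallyIntegrable, (hw 1).ae_locallyIntegrable,
    h.ae_velocity_div_conv hK] with t htD hti hv0 hv1 hw0 hw1 hdiv
  have hvi : ∀ i, LocallyIntegrable fun y => u t y i := fun i => by
    fin_cases i; exacts [hv0, hv1]
  have hwi : ∀ i, LocallyIntegrable fun y => θ t y * u t y i := fun i => by
    fin_cases i; exacts [hw0, hw1]
  have hη : ContDiff ℝ ∞ fun x => ψ (t, x) := hψ.comp (contDiff_const.prodMk contDiff_id)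
  have hηd : ∀ x v, fderiv ℝ (fun x => ψ (t, x)) x v = fderiv ℝ ψ (t, x) (0, v) := fun x v => by
    rw [← inner_spaceGrad_eq hψ, spaceGrad, inner_gradient_eq_fderiv]
  have key := integral_box_balance (Θ := conv K (θ t)) (η := fun x => ψ (t, x))
    (U := fun i => conv K fun y => u t y i) (W := fun i => conv K fun y => θ t y * u t y i) hG
    ((hK.contDiff_conv hti).of_le (by simp)) (hη.of_le (by simp))
    (fun i => (hK.contDiff_conv (hvi i)).of_le (by simp))
    (fun i => (hK.contDiff_conv (hwi i)).of_le (by simp)) (conv_isPeriodic _ (hθ.periodic t))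
    (hψp t) (fun i => conv_isPeriodic _ ((hv i).periodic t))
    (fun i => conv_isPeriodic _ ((hw i).periodic t))
    (fun x => by rw [hK.fderiv_conv hv0, hK.fderiv_conv hv1]; exact hdiv x)
  simp only [hηd, hK.fderiv_conv hw0, hK.fderiv_conv hw1] at key
  simp only [htD]
  rw [key]
  congr 1
  ext x
  simp only [A, fluxDiv, Fin.sum_univ_two]
  ring

end IsWeakSolution

/-! ### Convergence in `L^p` of products and compositions -/

/-- Convergence in `L^p` of real functions along a filter. -/
structure TendstoLp {ι X : Type*} [MeasurableSpace X] (p : ENNReal) (μ : Measure X) (l : Filter ι)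
    (F : ι → X → ℝ) (f : X → ℝ) : Prop where
  memLp : ∀ᶠ i in l, MemLp (F i) p μ
  memLp_lim : MemLp f p μ
  tendsto : Tendsto (fun i => eLpNorm (fun x => F i x - f x) p μ) l (𝓝 0)

namespace TendstoLp

variable {ι X : Type*} [MeasurableSpace X] {p : ENNReal} {μ : Measure X} {l : Filter ι}
  {F H : ι → X → ℝ} {f h : X → ℝ}

lemma of_le (hF : ∀ᶠ i in l, MemLp (F i) p μ) (hf : MemLp f p μ) {b : ι → ENNReal}
    (hb : Tendsto b l (𝓝 0)) (hle : ∀ᶠ i in l, eLpNorm (fun x => F i x - f x) p μ ≤ b i) :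
    TendstoLp p μ l F f :=
  ⟨hF, hf, tendsto_of_tendsto_of_tendsto_of_le_of_le' tendsto_const_nhds hb
    (Eventually.of_forall fun _ => zero_le) hle⟩

lemma sub (hp : 1 ≤ p) (hF : TendstoLp p μ l F f) (hH : TendstoLp p μ l H h) :
    TendstoLp p μ l (fun i x => F i x - H i x) fun x => f x - h x := by
  refine of_le ?_ (hF.memLp_lim.sub hH.memLp_lim)
    (by simpa using hF.tendsto.add hH.tendsto) ?_
  · filter_upwards [hF.memLp, hH.memLp] with i h1 h2 using h1.sub h2
  · filter_upwards [hF.memLp, hH.memLp] with i h1 h2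
    have := eLpNorm_sub_le (h1.sub hF.memLp_lim).1 (h2.sub hH.memLp_lim).1 hp
    refine le_trans (le_of_eq ?_) this
    congr 1
    ext x
    simp only [Pi.sub_apply]
    ring

lemma add (hp : 1 ≤ p) (hF : TendstoLp p μ l F f) (hH : TendstoLp p μ l H h) :
    TendstoLp p μ l (fun i x => F i x + H i x) fun x => f x + h x := by
  refine of_le ?_ (hF.memLp_lim.add hH.memLp_lim)
    (by simpa using hF.tendsto.add hH.tendsto) ?_
  · filter_upwards [hF.memLp, hH.memLp] with i h1 h2 using h1.add h2
  · filter_upwards [hF.memLp, hH.memLp] with i h1 h2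
    have := eLpNorm_add_le (h1.sub hF.memLp_lim).1 (h2.sub hH.memLp_lim).1 hp
    refine le_trans (le_of_eq ?_) this
    congr 1
    ext x
    simp only [Pi.sub_apply, Pi.add_apply]
    ring

lemma mono_exponent [IsFiniteMeasure μ] (hF : TendstoLp 2 μ l F f) : TendstoLp 1 μ l F f := by
  have hc : Tendsto (fun i => eLpNorm (fun x => F i x - f x) 2 μ *
      μ univ ^ (1 / (1 : ENNReal).toReal - 1 / (2 : ENNReal).toReal)) l (𝓝 0) := by
    have := ENNReal.Tendsto.mul_const hF.tendsto (b := μ univ ^ (1 / (1 : ENNReal).toReal -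
      1 / (2 : ENNReal).toReal))
      (Or.inr (ENNReal.rpow_ne_top_of_nonneg (by norm_num) (measure_ne_top _ _)))
    simpa only [zero_mul] using this
  refine of_le ?_ (hF.memLp_lim.mono_exponent (by norm_num)) hc ?_
  · filter_upwards [hF.memLp] with i h1 using h1.mono_exponent (by norm_num)
  · filter_upwards [hF.memLp] with i h1
    exact eLpNorm_le_eLpNorm_mul_rpow_measure_univ (by norm_num) (h1.sub hF.memLp_lim).1

/-- `G` need not vanish at 0; finiteness of the measure absorbs the constant `G 0`. -/
lemma _root_.LipschitzWith.comp_memLp_finite [IsFiniteMeasure μ] {G : ℝ → ℝ} {C : NNReal}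
    (hG : LipschitzWith C G) (hf : MemLp f p μ) : MemLp (fun x => G (f x)) p μ := by
  have h1 : LipschitzWith C fun s => G s - G 0 := by
    simpa using hG.sub (LipschitzWith.const (G 0))
  have := (h1.comp_memLp (by simp) hf).add (memLp_const (G 0))
  refine this.ae_eq (ae_of_all _ fun x => ?_)
  simp

lemma comp_lipschitz [IsFiniteMeasure μ] (hF : TendstoLp p μ l F f) {G : ℝ → ℝ} {C : NNReal}
    (hG : LipschitzWith C G) : TendstoLp p μ l (fun i x => G (F i x)) fun x => G (f x) := by
  have hc : Tendsto (fun i => C * eLpNorm (fun x => F i x - f x) p μ) l (𝓝 0) := by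
    simpa using ENNReal.Tendsto.const_mul hF.tendsto (Or.inr (ENNReal.coe_ne_top (r := C)))
  refine of_le ?_ (hG.comp_memLp_finite hF.memLp_lim) hc (Eventually.of_forall fun i => ?_)
  · filter_upwards [hF.memLp] with i h1 using hG.comp_memLp_finite h1
  · refine (eLpNorm_le_nnreal_smul_eLpNorm_of_ae_le_mul (f := fun x => G (F i x) - G (f x))
      (g := fun x => F i x - f x) (c := C) (ae_of_all _ fun x => ?_) p).trans
      (le_of_eq ?_)
    · exact NNReal.coe_le_coe.1 (by simpa [dist_eq_norm] using hG.dist_le_mul (F i x) (f x))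
    · rw [ENNReal.smul_def, smul_eq_mul]

lemma eLpNorm_mul_le {a b : X → ℝ} {p q r : ENNReal} [p.HolderTriple q r]
    (ha : AEStronglyMeasurable a μ) (hb : AEStronglyMeasurable b μ) :
    eLpNorm (fun x => a x * b x) r μ ≤ eLpNorm a p μ * eLpNorm b q μ :=
  eLpNorm_smul_le_mul_eLpNorm (p := p) (q := q) (r := r) (f := b) (φ := a) hb ha

/-- Hölder's inequality applied to `FH - fh = (F - f)(H - h) + (F - f)h + f(H - h)`. -/
lemma mul (hF : TendstoLp 2 μ l F f) (hH : TendstoLp 2 μ l H h) :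
    TendstoLp 1 μ l (fun i x => F i x * H i x) fun x => f x * h x := by
  have hc : Tendsto (fun i => eLpNorm (fun x => F i x - f x) 2 μ *
      eLpNorm (fun x => H i x - h x) 2 μ + (eLpNorm (fun x => F i x - f x) 2 μ * eLpNorm h 2 μ +
      eLpNorm f 2 μ * eLpNorm (fun x => H i x - h x) 2 μ)) l (𝓝 0) := by
    have h1 := ENNReal.Tendsto.mul hF.tendsto (Or.inr ENNReal.zero_ne_top) hH.tendsto
      (Or.inr ENNReal.zero_ne_top)
    have h2 := ENNReal.Tendsto.mul_const hF.tendsto (Or.inr hH.memLp_lim.2.ne)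
    have h3 := ENNReal.Tendsto.const_mul hH.tendsto (Or.inr hF.memLp_lim.2.ne)
    simpa using h1.add (h2.add h3)
  refine of_le ?_ (hH.memLp_lim.mul hF.memLp_lim) hc ?_
  · filter_upwards [hF.memLp, hH.memLp] with i h1 h2 using h2.mul h1
  · filter_upwards [hF.memLp, hH.memLp] with i h1 h2
    have m1 := (h1.sub hF.memLp_lim).1
    have m2 := (h2.sub hH.memLp_lim).1
    have m3 := hF.memLp_lim.1
    have m4 := hH.memLp_lim.1
    have e : (fun x => F i x * H i x - f x * h x) = (fun x => (F i x - f x) * (H i x - h x)) +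
        ((fun x => (F i x - f x) * h x) + fun x => f x * (H i x - h x)) := by
      ext x; simp only [Pi.add_apply]; ring
    rw [e]
    refine (eLpNorm_add_le (m1.mul m2) ((m1.mul m4).add (m3.mul m2)) le_rfl).trans ?_
    refine add_le_add (eLpNorm_mul_le m1 m2) ?_
    refine (eLpNorm_add_le (m1.mul m4) (m3.mul m2) le_rfl).trans ?_
    exact add_le_add (eLpNorm_mul_le m1 m4) (eLpNorm_mul_le m3 m2)

lemma mul_bounded (hF : TendstoLp 1 μ l F f) {b : X → ℝ} (hb : MemLp b ⊤ μ) :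
    TendstoLp 1 μ l (fun i x => F i x * b x) fun x => f x * b x := by
  have hc : Tendsto (fun i => eLpNorm (fun x => F i x - f x) 1 μ * eLpNorm b ⊤ μ) l (𝓝 0) := by
    simpa using ENNReal.Tendsto.mul_const hF.tendsto (Or.inr hb.2.ne)
  refine of_le ?_ (hb.mul hF.memLp_lim) hc ?_
  · filter_upwards [hF.memLp] with i h1 using hb.mul h1
  · filter_upwards [hF.memLp] with i h1
    simp only [← sub_mul]
    exact eLpNorm_mul_le (h1.sub hF.memLp_lim).1 hb.1

/-- The multipliers need not converge: for `G'(θ_ε)` in front of the commutator only the uniform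
bound matters. -/
lemma bounded_mul_zero (hF : TendstoLp p μ l F fun _ => 0) {m : ι → X → ℝ} {C : ℝ}
    (hm : ∀ᶠ i in l, AEStronglyMeasurable (m i) μ) (hC : ∀ i x, |m i x| ≤ C) :
    TendstoLp p μ l (fun i x => m i x * F i x) fun _ => 0 := by
  have hc : Tendsto (fun i => ENNReal.ofReal C * eLpNorm (fun x => F i x - 0) p μ) l (𝓝 0) := by
    simpa using ENNReal.Tendsto.const_mul hF.tendsto (Or.inr ENNReal.ofReal_ne_top)
  have hle : ∀ i x, ‖m i x * F i x‖ ≤ C * ‖F i x‖ := fun i x => by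
    rw [norm_mul]
    exact mul_le_mul_of_nonneg_right (hC i x) (norm_nonneg _)
  refine of_le ?_ hF.memLp_lim hc (Eventually.of_forall fun i => ?_)
  · filter_upwards [hF.memLp, hm] with i h1 h2
    exact h1.of_le_mul (h2.mul h1.1) (ae_of_all _ (hle i))
  · simp only [sub_zero]
    exact eLpNorm_le_mul_eLpNorm_of_ae_le_mul (ae_of_all _ (hle i)) p

lemma tendsto_integral (hF : TendstoLp 1 μ l F f) :
    Tendsto (fun i => ∫ x, F i x ∂μ) l (𝓝 (∫ x, f x ∂μ)) :=
  tendsto_integral_of_L1' f hF.memLp_lim.1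
    (hF.memLp.mono fun _ h => memLp_one_iff_integrable.1 h) hF.tendsto

end TendstoLp

/-! ### The limit distribution -/

namespace IsWeakSolution

variable {T : ℝ} {θ₀ : Plane → ℝ} {θ : ℝ → Plane → ℝ} {u : ℝ → Plane → Plane} {G : ℝ → ℝ}
  {C : NNReal}

lemma memLp_comp (h : IsWeakSolution T θ₀ θ u) (hGL : LipschitzWith C G) :
    MemLp (fun z : ℝ × Plane => G (θ z.1 z.2)) 2 (volume.restrict (slab T)) :=
  hGL.comp_memLp_finite (h.boundedFamily_scalar.memLp_slab (by simp) (by simp))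

lemma memLp_velocity (h : IsWeakSolution T θ₀ θ u) :
    MemLp (fun z : ℝ × Plane => u z.1 z.2) 2 (volume.restrict (slab T)) :=
  h.boundedFamily_velocity.memLp_slab (by simp) (by simp)

lemma memLp_velocity_coord (h : IsWeakSolution T θ₀ θ u) (i : Fin 2) :
    MemLp (fun z : ℝ × Plane => u z.1 z.2 i) 2 (volume.restrict (slab T)) :=
  (h.boundedFamily_coord i).memLp_slab (by simp) (by simp)

lemma integrable_weight (h : IsWeakSolution T θ₀ θ u) (hGL : LipschitzWith C G) :
    Integrable (fun z : ℝ × Plane => |G (θ z.1 z.2)| * (1 + ‖u z.1 z.2‖))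
      (volume.restrict (slab T)) :=
  memLp_one_iff_integrable.1 (MemLp.mul (p := 2) (q := 2)
    ((memLp_const (1 : ℝ)).add h.memLp_velocity.norm) (h.memLp_comp hGL).norm)

lemma norm_fderiv_le (L : ℝ × Plane →L[ℝ] ℝ) (v : Plane) : ‖L (1, v)‖ ≤ ‖L‖ * (1 + ‖v‖) := by
  refine (L.le_opNorm _).trans (mul_le_mul_of_nonneg_left ?_ (norm_nonneg _))
  rw [Prod.norm_def, norm_one]
  exact max_le (by linarith [norm_nonneg v]) (by linarith)

lemma integrable_transport (h : IsWeakSolution T θ₀ θ u) (hGL : LipschitzWith C G)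
    {ψ : ℝ × Plane → ℝ} (hψ : ContDiff ℝ ∞ ψ) :
    Integrable (fun z : ℝ × Plane => G (θ z.1 z.2) * fderiv ℝ ψ z (1, u z.1 z.2))
      (volume.restrict (slab T)) := by
  have mψ : ∀ v, MemLp (fun z => fderiv ℝ ψ z v) ⊤ (volume.restrict (slab T)) := fun v =>
    (continuous_fderiv_apply hψ v).memLp_slab ⊤
  have m : ∀ i, MemLp (fun z : ℝ × Plane => u z.1 z.2 i * fderiv ℝ ψ z (0, dir i)) 2
      (volume.restrict (slab T)) := fun i =>
    (mψ _).mul (h.memLp_velocity_coord i)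
  have key := memLp_one_iff_integrable.1 (MemLp.mul (p := 2) (q := 2)
    (((mψ (1, 0)).mono_exponent le_top).add ((m 0).add (m 1))) (h.memLp_comp hGL))
  refine key.congr (ae_of_all _ fun z => ?_)
  simp only [Pi.mul_apply, Pi.add_apply]
  rw [fderiv_eq_sum ψ z (u z.1 z.2)]

/-- The distribution `∂_t G(θ) + u·∇G(θ)`, up to sign. -/
noncomputable def limitDistribution (h : IsWeakSolution T θ₀ θ u) (hGL : LipschitzWith C G) :
    testFunctions (Ioo 0 T) →ₗ[ℝ] ℝ where
  toFun ψ := ∫ z in slab T, G (θ z.1 z.2) * fderiv ℝ ψ.1 z (1, u z.1 z.2)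
  map_add' ψ ζ := by
    rw [← integral_add (h.integrable_transport hGL ψ.2.1) (h.integrable_transport hGL ζ.2.1)]
    congr 1
    ext z
    have : fderiv ℝ (ψ + ζ).1 z = fderiv ℝ ψ.1 z + fderiv ℝ ζ.1 z :=
      fderiv_add (ψ.2.1.differentiable (by simp) z) (ζ.2.1.differentiable (by simp) z)
    rw [this, _root_.add_apply, mul_add]
  map_smul' c ψ := by
    rw [RingHom.id_apply, smul_eq_mul, ← integral_const_mul]
    congr 1
    ext z
    have : fderiv ℝ (c • ψ).1 z = c • fderiv ℝ ψ.1 z :=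
      fderiv_const_smul (ψ.2.1.differentiable (by simp) z) c
    rw [this, _root_.smul_apply, smul_eq_mul]
    ring

lemma isDistribution_limitDistribution (h : IsWeakSolution T θ₀ θ u) (hGL : LipschitzWith C G) :
    IsDistribution (h.limitDistribution hGL) := by
  -- Only first derivatives of `ψ` occur, so the order is 1, with a constant independent of `K`.
  refine fun K _ _ => ⟨1, ∫ z in slab T, |G (θ z.1 z.2)| * (1 + ‖u z.1 z.2‖),
    fun ψ _ M hM => ?_⟩
  change ‖∫ z in slab T, G (θ z.1 z.2) * fderiv ℝ ψ.1 z (1, u z.1 z.2)‖ ≤ _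
  rw [← integral_mul_const]
  refine norm_integral_le_of_norm_le ((h.integrable_weight hGL).mul_const M)
    (ae_of_all _ fun z => ?_)
  have h1 : ‖fderiv ℝ ψ.1 z‖ ≤ M := by
    rw [← norm_iteratedFDeriv_one]; exact hM 1 le_rfl z
  rw [norm_mul, Real.norm_eq_abs, mul_assoc]
  gcongr
  refine (norm_fderiv_le _ _).trans ?_
  rw [mul_comm]
  gcongr

lemma transportEq_limitDistribution (h : IsWeakSolution T θ₀ θ u) (hGL : LipschitzWith C G) :
    TransportEq T (fun t x => G (θ t x)) u (-h.limitDistribution hGL) := by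
  refine ⟨(h.memLp_comp hGL).integrable (by norm_num), ?_, fun ψ => ?_⟩
  · exact memLp_one_iff_integrable.1 (MemLp.smul (p := 2) (q := 2) h.memLp_velocity
      (h.memLp_comp hGL))
  · simp only [transport_eq_fderiv ψ.2.1]
    rfl

lemma tendstoLp_conv {f : ℝ → Plane → ℝ} {p : ENNReal} (hf : BoundedFamily T p f)
    (hf1 : BoundedFamily T 1 f) (hp1 : 1 ≤ p) (hp : p ≠ ⊤) {φ : Plane → ℝ} (hφ : IsMollifier φ) :
    TendstoLp p (volume.restrict (slab T)) (𝓝[>] 0)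
      (fun ε (z : ℝ × Plane) => conv (rescale φ ε) (f z.1) z.2) fun z => f z.1 z.2 := by
  refine ⟨?_, hf.memLp_slab (zero_lt_one.trans_le hp1).ne' hp, hf.tendsto_mollify hp1 hp hφ⟩
  filter_upwards [self_mem_nhdsWithin] with ε hε
  exact hf1.memLp_conv (hφ.isKernel hε) p

lemma convergesInDistribution_defect (h : IsWeakSolution T θ₀ θ u) (hT : 0 < T)
    (hG : ContDiff ℝ 2 G) (hGL : LipschitzWith C G) {φ : Plane → ℝ} (hφ : IsMollifier φ) :
    ConvergesInDistribution T (defect φ G θ u) (h.limitDistribution hGL) := by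
  -- Integrability of the defect does not involve the test function, so 0 is supplied.
  refine ⟨fun ε hε => (h.integral_slab_defect hT hG hGL (hφ.isKernel hε) 0).1, fun ψ => ?_⟩
  have hθ := h.boundedFamily_scalar
  have lΘ := tendstoLp_conv hθ hθ.of_two (by norm_num) (by norm_num) hφ
  have lU := fun i => tendstoLp_conv (h.boundedFamily_coord i) (h.boundedFamily_coord i).of_two
    (by norm_num) (by norm_num) hφ
  have lW := fun i => tendstoLp_conv (h.boundedFamily_flux i) (h.boundedFamily_flux i) le_rfl
    ENNReal.one_ne_top hφ
  have mψ : ∀ v, MemLp (fun z => fderiv ℝ ψ.1 z v) ⊤ (volume.restrict (slab T)) := fun v =>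
    (continuous_fderiv_apply ψ.2.1 v).memLp_slab ⊤
  have lG := lΘ.comp_lipschitz hGL
  have lR : ∀ i, TendstoLp 1 (volume.restrict (slab T)) (𝓝[>] 0)
      (fun ε (z : ℝ × Plane) => deriv G (conv (rescale φ ε) (θ z.1) z.2) *
          (conv (rescale φ ε) (θ z.1) z.2 * conv (rescale φ ε) (fun y => u z.1 y i) z.2 -
            conv (rescale φ ε) (fun y => θ z.1 y * u z.1 y i) z.2)) fun _ => 0 := by
    intro i
    -- The commutator: `θ_ε u_ε` and `(uθ)_ε` both tend to `uθ` in `L¹`.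
    have l0 := (lΘ.mul (lU i)).sub le_rfl (lW i)
    simp only [sub_self] at l0
    refine l0.bounded_mul_zero (C := C) ?_ fun ε z => ?_
    · filter_upwards [lΘ.memLp] with ε hε
      exact (hG.continuous_deriv (by norm_num)).comp_aestronglyMeasurable hε.1
    · exact norm_deriv_le_of_lipschitz hGL
  have lim := ((lG.mono_exponent.mul_bounded (mψ (1, 0))).add le_rfl
    (((((lG.mul (lU 0)).mul_bounded (mψ (0, dir 0))).add le_rfl
      ((lG.mul (lU 1)).mul_bounded (mψ (0, dir 1))))).sub le_rfl
    (((lR 0).mul_bounded (mψ (0, dir 0))).add le_rfl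
      ((lR 1).mul_bounded (mψ (0, dir 1)))))).tendsto_integral
  have e : h.limitDistribution hGL ψ = ∫ z in slab T, (G (θ z.1 z.2) * fderiv ℝ ψ.1 z (1, 0) +
      (G (θ z.1 z.2) * u z.1 z.2 0 * fderiv ℝ ψ.1 z (0, dir 0) +
        G (θ z.1 z.2) * u z.1 z.2 1 * fderiv ℝ ψ.1 z (0, dir 1) -
      (0 * fderiv ℝ ψ.1 z (0, dir 0) + 0 * fderiv ℝ ψ.1 z (0, dir 1)))) := by
    change ∫ z in slab T, G (θ z.1 z.2) * fderiv ℝ ψ.1 z (1, u z.1 z.2) = _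
    congr 1
    ext z
    rw [fderiv_eq_sum]
    ring
  rw [e]
  refine lim.congr' ?_
  filter_upwards [self_mem_nhdsWithin] with ε hε
  rw [(h.integral_slab_defect hT hG hGL (hφ.isKernel hε) ψ).2]
  simp only [Fin.sum_univ_two]

end IsWeakSolution

end QG

theorem theorem4p2 (T : ℝ) (hT : 0 < T)
    (θ₀ : QG.Plane → ℝ) (hθ₀_per : QG.IsPeriodic θ₀)
    (hθ₀ : MemLp θ₀ 2 (volume.restrict QG.box))
    (θ : ℝ → QG.Plane → ℝ) (u : ℝ → QG.Plane → QG.Plane)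
    (hsol : QG.IsWeakSolution T θ₀ θ u)
    (G : ℝ → ℝ) (hG : ContDiff ℝ 2 G) (hGconv : StrictConvexOn ℝ univ G)
    (hGbdd : ∃ M : ℝ, ∀ s, |deriv G s| ≤ M) :
    ∃ F : QG.testFunctions (Ioo 0 T) →ₗ[ℝ] ℝ,
      QG.IsDistribution F ∧
      (∀ φ : QG.Plane → ℝ, QG.IsMollifier φ →
        QG.ConvergesInDistribution T (QG.defect φ G θ u) F) ∧
      QG.TransportEq T (fun t x => G (θ t x)) u (-F) := by
  obtain ⟨M, hM⟩ := hGbdd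
  -- The bound on `G'` enters the proof only through this Lipschitz property.
  have hGL : LipschitzWith M.toNNReal G :=
    lipschitzWith_of_nnnorm_deriv_le (hG.differentiable (by simp)) fun s =>
      NNReal.le_toNNReal_of_coe_le (hM s)
  exact ⟨hsol.limitDistribution hGL, hsol.isDistribution_limitDistribution hGL,
    fun φ hφ => hsol.convergesInDistribution_defect hT hG hGL hφ,
    hsol.transportEq_limitDistribution hGL⟩
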